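/- Let $k\ge 1$ be an integer. For $n\ge 1$ put $A_n(k)=\sum_{1\le v\le n,\ v\equiv n\ (\mathrm{mod}\ k)}\frac1v$; equivalently, $-\frac{\log(1-x)}{1-x^k}=\sum_{n\ge1}A_n(k)x^n$ for $|x|<1$. The series $\zeta_{A(k)}(s)=\sum_{n\ge1}A_n(k)\,n^{-s}$ converges absolutely for $\operatorname{Re}s>1$. Put $$I(s,k)=\frac1{2\pi i}\int_C \frac{z^{s-1}e^{kz}}{e^{kz}-1}\log\Big(\frac{e^z-1}{z}\Big)\,dz,$$ where the logarithm is principal and $C=C_-\cup C_\varepsilon\cup C_+$ is the Hankel contour: $C_-$ comes in from $-\infty$ to $-\varepsilon$ along the lower edge of the negative real axis ($\arg z=-\pi$), $C_\varepsilon$ is the circle $|z|=\varepsilon$ run through counter-clockwise from $\arg z=-\pi$ to $\arg z=\pi$, and $C_+$ returns to $-\infty$ along the upper edge ($\arg z=\pi$); here $\varepsilon$ is any number with $0<\varepsilon<\pi$ and $k\varepsilon<2\pi$, and $z^{s-1}=e^{(s-1)(\log|z|+i\arg z)}$. The integral converges absolutely for every $s\in\mathbb C$ and is an entire function of $s$.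 The function $\zeta_{A(k)}$ has a meromorphic continuation to $\mathbb C$, holomorphic except for poles at $s=1$, $s=0$ and $s=1-2j$ ($j=1,2,3,\dots$), and given, for every such $\varepsilon$, by $$\zeta_{A(k)}(s)=\Gamma(1-s)\,I(s,k)+\zeta(s+1)-\frac1{k^s}\big(\psi(s)\zeta(s)+\zeta'(s)-\zeta(s)\log k\big),$$ where $\psi=\Gamma'/\Gamma$ and $\zeta$ is the Riemann zeta function. The formula holds at every $s\notin\mathbb Z$, and in the sense of limits at every integer that is not one of these poles. Moreover: - $s=1$ is a double pole, with principal part $\dfrac{1/k}{(s-1)^2}+\dfrac{\gamma/k}{s-1}$, so that the residue is $\gamma/k$, where $\gamma$ is Euler's constant; - $s=0$ is a simple pole with residue $1+\zeta(0)$; - for each $j\ge1$, $s=1-2j$ is a simple pole with residue $k^{2j-1}\zeta(1-2j)=-k^{2j-1}\dfrac{B_{2j}}{2j}$, where $B_n$ are the Bernoulli numbers. -/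

import Mathlib

open Filter Topology MeasureTheory

noncomputable section

namespace HarmonicZeta

/-- `A k n = ∑ 1 / v` over `1 ≤ v ≤ n` with `v ≡ n (mod k)`; in particular `A k 0 = 0`. -/
def A (k n : ℕ) : ℚ :=
  ∑ v ∈ (Finset.Icc 1 n).filter (fun v => v ≡ n [MOD k]), (1 : ℚ) / v

/-- The Dirichlet series `∑_{n ≥ 1} A k n / n ^ s`. -/
def zetaA (k : ℕ) (s : ℂ) : ℂ :=
  LSeries (fun n => (A k n : ℂ)) s

/-- The integrand `z ^ (s - 1) * e ^ (k z) / (e ^ (k z) - 1) * log ((e ^ z - 1) / z)` at the point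
`z = r e ^ (i θ)` with argument `θ`, so that `z ^ (s - 1) = exp ((s - 1) (log r + i θ))`. The
argument matters since `θ = -π` and `θ = π` are different edges of the cut. The logarithm of
`(e ^ z - 1) / z` is the principal one. -/
def hankelIntegrand (k : ℕ) (s : ℂ) (r θ : ℝ) : ℂ :=
  let z : ℂ := r * Complex.exp (θ * Complex.I)
  Complex.exp ((s - 1) * (Real.log r + θ * Complex.I)) *
    (Complex.exp (k * z) / (Complex.exp (k * z) - 1)) *
    Complex.log ((Complex.exp z - 1) / z)

/-- `1 / (2 π i)` times the integral of `hankelIntegrand k s` over the Hankel contour with radius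
`ε`: the lower edge `z = x e ^ (-i π)`, with `x` decreasing from `∞` to `ε`; the circle
`z = ε e ^ (i θ)`, with `θ` increasing from `-π` to `π`; the upper edge `z = x e ^ (i π)`, with `x`
increasing from `ε` to `∞`. On both edges `dz = -dx`. -/
def hankelI (k : ℕ) (ε : ℝ) (s : ℂ) : ℂ :=
  (1 / (2 * Real.pi * Complex.I)) *
    ((∫ x in Set.Ioi ε, hankelIntegrand k s x (-Real.pi))
      + (∫ θ in (-Real.pi)..Real.pi,
          hankelIntegrand k s ε θ * (Complex.I * ε * Complex.exp (θ * Complex.I)))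
      - (∫ x in Set.Ioi ε, hankelIntegrand k s x Real.pi))

/-- All three integrals in `hankelI k ε s` converge absolutely. -/
def HankelConverges (k : ℕ) (ε : ℝ) (s : ℂ) : Prop :=
  IntegrableOn (fun x => hankelIntegrand k s x (-Real.pi)) (Set.Ioi ε) ∧
  IntervalIntegrable
    (fun θ => hankelIntegrand k s ε θ * (Complex.I * ε * Complex.exp (θ * Complex.I)))
    volume (-Real.pi) Real.pi ∧
  IntegrableOn (fun x => hankelIntegrand k s x Real.pi) (Set.Ioi ε)

/-- `Γ(1 - s) I(s, k) + ζ(s + 1) - k ^ (-s) (ψ(s) ζ(s) + ζ'(s) - ζ(s) log k)`, with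
`I(s, k) = hankelI k ε s`. -/
def contourFormula (k : ℕ) (ε : ℝ) (s : ℂ) : ℂ :=
  Complex.Gamma (1 - s) * hankelI k ε s + riemannZeta (s + 1)
    - (k : ℂ) ^ (-s) * (Complex.digamma s * riemannZeta s + deriv riemannZeta s
        - riemannZeta s * Complex.log k)

/-- The points `1`, `0` and `1 - 2 j` for `j = 1, 2, 3, …`. -/
def poles : Set ℂ :=
  {s | s = 1 ∨ s = 0 ∨ ∃ j : ℕ, 1 ≤ j ∧ s = 1 - 2 * (j : ℂ)}

/-- The Laurent expansion of `f` at `a` has principal part `c₂ / (s - a) ^ 2 + c₁ / (s - a)`. In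
particular `c₁` is the residue of `f` at `a`. -/
def HasPrincipalPart (f : ℂ → ℂ) (a c₂ c₁ : ℂ) : Prop :=
  ∃ g : ℂ → ℂ, AnalyticAt ℂ g a ∧
    ∀ᶠ s in 𝓝[≠] a, f s = c₂ / (s - a) ^ 2 + c₁ / (s - a) + g s

end HarmonicZeta

end

namespace HarmonicZeta

/-! For `re s > 1`, termwise integration of the generating function at `x = e^{-t}` shows that `Γ(s)
(ζ_A(s) - ζ(s+1))` is the Mellin transform of `-log(1 - e^{-t}) / (e^{kt} - 1)`. Write `log(1 -
e^{-t}) = log((1 - e^{-t})/t) + log t`. The `log t` half contributes the `s`-derivative of `Γ(s)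
k^{-s} ζ(s)`; divided by `Γ(s)`, this is the digamma bracket. The other half, `edgeKernel`, is
bounded near `0`, so its Mellin transform `M` is holomorphic for `re s > 0` (`Gamma_mul_zetaA_sub`).

The Hankel integral continues `M` further. It does not depend on the radius (Cauchy,
`hankelI_eq_of_le`), and collapsing the contour onto the cut gives `I = -(sin πs / π) M`
(`hankelI_eq_mellin`). By the reflection formula `Γ(1-s) I = -M/Γ(s)` off the integers, which proves
the formula for non-integral `s` with `re s > 1`.

The product `Γ(1-s) I` has only removable singularities: `Γ(1-s)` is regular for `re s ≤ 0`, and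
`-M/Γ` is regular for `re s > 0`. All poles therefore come from `ζ(s+1)`, `ψ`, `ζ` and `ζ'`, and are
read off by a small calculus of principal parts. The trivial zeros of `ζ` cancel the poles of `ψ` at
negative even integers. The continuation is the right-hand side with its removable singularities
filled in. -/

/-! ### Generating function and Dirichlet series -/

lemma A_zero (k : ℕ) : A k 0 = 0 := by simp [A]

/-- These are the Cauchy product coefficients of `-log(1-x)` and `1/(1-x^k)`. The extra index `0` is
harmless because `1 / 0 = 0`. -/
lemma A_eq_sum_antidiagonal (k n : ℕ) :
    (A k n : ℂ) = ∑ p ∈ Finset.HasAntidiagonal.antidiagonal n, (1 / (p.1 : ℂ)) * (if k ∣ p.2 then 1 else 0) := by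
  rw [Finset.Nat.sum_antidiagonal_eq_sum_range_succ
    (fun i j => (1 / (i : ℂ)) * (if k ∣ j then 1 else 0)), A, Finset.sum_filter]
  have : Finset.range n.succ = insert 0 (Finset.Icc 1 n) := by
    ext i; simp; omega
  rw [this, Finset.sum_insert (by simp)]
  push_cast
  simp only [div_zero, zero_mul, zero_add]
  refine Finset.sum_congr rfl fun v hv => ?_
  simp only [Nat.modEq_iff_dvd' (Finset.mem_Icc.mp hv).2]
  split_ifs <;> simp

lemma hasSum_dvd_geometric {k : ℕ} (hk : 1 ≤ k) {x : ℂ} (hx : ‖x‖ < 1) :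
    HasSum (fun n : ℕ => (if k ∣ n then (1 : ℂ) else 0) * x ^ n) (1 - x ^ k)⁻¹ := by
  have hinj : Function.Injective (fun m : ℕ => k * m) := fun a b h =>
    Nat.eq_of_mul_eq_mul_left hk h
  rw [← hinj.hasSum_iff]
  · have : ‖x ^ k‖ < 1 := by
      rw [norm_pow]; exact pow_lt_one₀ (norm_nonneg _) hx (by omega)
    simpa [Function.comp_def, pow_mul] using hasSum_geometric_of_norm_lt_one this
  · intro n hn
    rw [if_neg, zero_mul]
    rintro ⟨m, rfl⟩
    exact hn ⟨m, rfl⟩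

theorem hasSum_A {k : ℕ} (hk : 1 ≤ k) {x : ℂ} (hx : ‖x‖ < 1) :
    HasSum (fun n : ℕ => (A k n : ℂ) * x ^ n) (-Complex.log (1 - x) / (1 - x ^ k)) := by
  have h1 := Complex.hasSum_taylorSeries_neg_log hx
  have h2 := hasSum_dvd_geometric hk hx
  have e : ∀ n : ℕ, (A k n : ℂ) * x ^ n = ∑ p ∈ Finset.HasAntidiagonal.antidiagonal n,
      (x ^ p.1 / (p.1 : ℂ)) * ((if k ∣ p.2 then (1 : ℂ) else 0) * x ^ p.2) := fun n => by
    rw [A_eq_sum_antidiagonal, Finset.sum_mul]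
    refine Finset.sum_congr rfl fun p hp => ?_
    rw [← Finset.HasAntidiagonal.mem_antidiagonal.mp hp, pow_add]
    ring
  simp_rw [e]
  rw [div_eq_mul_inv, ← h1.tsum_eq, ← h2.tsum_eq,
    tsum_mul_tsum_eq_tsum_sum_antidiagonal_of_summable_norm h1.summable.norm h2.summable.norm]
  exact (summable_norm_sum_mul_antidiagonal_of_summable_norm h1.summable.norm
    h2.summable.norm).of_norm.hasSum

lemma norm_A_le (k n : ℕ) : ‖(A k n : ℂ)‖ ≤ 1 + Real.log n := by
  have h : A k n ≤ harmonic n := by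
    rw [harmonic_eq_sum_Icc, A]
    simp only [one_div]
    exact Finset.sum_le_sum_of_subset_of_nonneg (Finset.filter_subset _ _)
      fun _ _ _ => by positivity
  have h0 : 0 ≤ A k n := Finset.sum_nonneg fun _ _ => by positivity
  have : ‖(A k n : ℂ)‖ = (A k n : ℝ) := by
    rw [← Complex.ofReal_ratCast, Complex.norm_real, Real.norm_of_nonneg (by exact_mod_cast h0)]
  rw [this]
  exact le_trans (by exact_mod_cast h) (harmonic_le_one_add_log n)

lemma A_isBigO (k : ℕ) {e : ℝ} (he : 0 < e) :
    (fun n => (A k n : ℂ)) =O[atTop] fun n : ℕ => (n : ℝ) ^ e := by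
  have h1 : (fun x : ℝ => 1 + Real.log x) =O[atTop] fun x : ℝ => x ^ e := by
    refine Asymptotics.IsBigO.add ?_ (isLittleO_log_rpow_atTop he).isBigO
    refine Asymptotics.IsBigO.of_bound 1 ?_
    filter_upwards [eventually_ge_atTop 1] with x hx
    have := Real.one_le_rpow hx he.le
    rw [norm_one, one_mul]
    exact this.trans (le_abs_self _)
  refine Asymptotics.IsBigO.trans ?_ (h1.comp_tendsto tendsto_natCast_atTop_atTop)
  refine Asymptotics.IsBigO.of_bound 1 (Eventually.of_forall fun n => ?_)
  rw [one_mul]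
  exact (norm_A_le k n).trans (le_abs_self _)

theorem lseriesSummable_A (k : ℕ) {s : ℂ} (hs : 1 < s.re) :
    LSeriesSummable (fun n => (A k n : ℂ)) s := by
  refine LSeriesSummable_of_isBigO_rpow (x := (1 + s.re) / 2) (by linarith) ?_
  exact A_isBigO k (by linarith)

theorem analyticAt_zetaA (k : ℕ) {s : ℂ} (hs : 1 < s.re) : AnalyticAt ℂ (zetaA k) s := by
  refine LSeries_analyticOnNhd (fun n => (A k n : ℂ)) s ?_
  have h := LSeries.abscissaOfAbsConv_le_of_isBigO_rpow
    (A_isBigO k (e := (s.re - 1) / 2) (by linarith))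
  refine lt_of_le_of_lt h ?_
  rw [← EReal.coe_one, ← EReal.coe_add, EReal.coe_lt_coe_iff]
  linarith

/-! ### Mellin transforms for `re s > 1` -/

/-- `A k n - 1 / n`, the coefficient obtained by leaving out the term `v = n`. -/
noncomputable def coeffSub (k n : ℕ) : ℂ := (A k n : ℂ) - 1 / n

/-- Dropping `v = n` replaces `1/(1-x^k)` by `x^k/(1-x^k)`, which is `1/(e^{kt}-1)` at `x = e^{-t}`.
With this denominator the `log t` half also decays at infinity once it is split off. -/
lemma hasSum_coeffSub {k : ℕ} (hk : 1 ≤ k) {t : ℝ} (ht : 0 < t) :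
    HasSum (fun n : ℕ => coeffSub k n * (Real.exp (-(n : ℝ) * t) : ℂ))
      (-(Real.log (1 - Real.exp (-t)) / (Real.exp (k * t) - 1) : ℝ)) := by
  have h1 : Real.exp (-t) < 1 := by simpa using ht
  have h0 := Real.exp_pos (-t)
  have hx : ‖(Real.exp (-t) : ℂ)‖ < 1 := by
    rw [Complex.norm_real, Real.norm_of_nonneg h0.le]; exact h1
  have h := (hasSum_A hk hx).sub (Complex.hasSum_taylorSeries_neg_log hx)
  have hkt : 1 < Real.exp (k * t) := by
    rw [Real.one_lt_exp_iff]; positivity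
  have ev : (-(Real.log (1 - Real.exp (-t)) / (Real.exp (k * t) - 1) : ℝ) : ℂ)
      = -Complex.log (1 - (Real.exp (-t) : ℂ)) / (1 - (Real.exp (-t) : ℂ) ^ k)
        - -Complex.log (1 - (Real.exp (-t) : ℂ)) := by
    have e : (Real.exp (-t)) ^ k = (Real.exp (k * t))⁻¹ := by
      rw [← Real.exp_nat_mul, ← Real.exp_neg]; ring_nf
    rw [← Complex.ofReal_pow, e, ← Complex.ofReal_one, ← Complex.ofReal_sub, ← Complex.ofReal_sub,
      ← Complex.ofReal_log (by linarith)]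
    norm_cast
    have h2 : Real.exp (k * t) - 1 ≠ 0 := by linarith
    have h3 : Real.exp (k * t) ≠ 0 := (Real.exp_pos _).ne'
    generalize Real.exp (k * t) = E at h2 h3
    have h4 : 1 - E⁻¹ = (E - 1) / E := by field_simp
    rw [h4]
    field_simp
    ring
  have hf : ∀ n : ℕ, coeffSub k n * (Real.exp (-(n : ℝ) * t) : ℂ)
      = (A k n : ℂ) * (Real.exp (-t) : ℂ) ^ n - (Real.exp (-t) : ℂ) ^ n / n := fun n => by
    simp only [coeffSub]
    rw [← Complex.ofReal_pow, ← Real.exp_nat_mul]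
    ring_nf
  rw [ev]
  simpa only [hf] using h

theorem mellin_log_div {k : ℕ} (hk : 1 ≤ k) {s : ℂ} (hs : 1 < s.re) :
    mellin (fun t => -((Real.log (1 - Real.exp (-t)) / (Real.exp (k * t) - 1) : ℝ) : ℂ)) s
      = Complex.Gamma s * (zetaA k s - riemannZeta (s + 1)) := by
  have e1 : ∀ n : ℕ, LSeries.term (fun n => (A k n : ℂ)) s n = (A k n : ℂ) / (n : ℂ) ^ s := by
    intro n
    rcases eq_or_ne n 0 with rfl | hn
    · simp [A_zero]
    · rw [LSeries.term_of_ne_zero hn]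
  have hs0' : s + 1 ≠ 0 := fun h => by
    have := congrArg Complex.re h
    simp at this
    linarith
  have e2 : ∀ n : ℕ, 1 / (n : ℂ) ^ (s + 1) = 1 / (n : ℂ) / (n : ℂ) ^ s := by
    intro n
    rcases eq_or_ne n 0 with rfl | hn
    · simp [hs0']
    · rw [Complex.cpow_add _ _ (by exact_mod_cast hn), Complex.cpow_one]
      field_simp
  have h1 : HasSum (fun n : ℕ => (A k n : ℂ) / (n : ℂ) ^ s) (zetaA k s) := by
    simpa only [zetaA, LSeries, ← e1] using (lseriesSummable_A k hs).hasSum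
  have hs1 : 1 < (s + 1).re := by simp; linarith
  have h2 : HasSum (fun n : ℕ => 1 / (n : ℂ) / (n : ℂ) ^ s) (riemannZeta (s + 1)) := by
    rw [zeta_eq_tsum_one_div_nat_cpow hs1]
    simpa only [e2] using (Complex.summable_one_div_nat_cpow.mpr hs1).hasSum
  have h3 : HasSum (fun n : ℕ => coeffSub k n / (n : ℂ) ^ s)
      (zetaA k s - riemannZeta (s + 1)) := by
    simpa only [coeffSub, sub_div] using h1.sub h2
  have h4 := hasSum_mellin (a := coeffSub k) (p := fun n : ℕ => (n : ℝ)) (s := s)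
    (F := fun t => -((Real.log (1 - Real.exp (-t)) / (Real.exp (k * t) - 1) : ℝ) : ℂ))
    -- The exponent `0` at `n = 0` is allowed only because the coefficient there vanishes.
    (fun n => by
      rcases eq_or_ne n 0 with rfl | hn
      · left; simp [coeffSub, A_zero]
      · right; positivity)
    (by linarith) (fun t ht => hasSum_coeffSub hk ht)
    (by
      refine h3.summable.norm.congr fun n => ?_
      rcases eq_or_ne n 0 with rfl | hn
      · simp [coeffSub, A_zero]
      · rw [norm_div, Complex.norm_natCast_cpow_of_pos (by omega)])
  refine h4.unique ?_
  simpa [mul_div_assoc] using h3.mul_left (Complex.Gamma s)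

lemma hasSum_exp_geometric {k : ℕ} (hk : 1 ≤ k) {t : ℝ} (ht : 0 < t) :
    HasSum (fun n : ℕ => (1 : ℂ) * (Real.exp (-(k * (n + 1) : ℝ) * t) : ℂ))
      (((Real.exp (k * t) - 1)⁻¹ : ℝ) : ℂ) := by
  have hkt : 1 < Real.exp (k * t) := by
    rw [Real.one_lt_exp_iff]; positivity
  have hr : (Real.exp (k * t))⁻¹ < 1 := inv_lt_one_of_one_lt₀ hkt
  have h := (hasSum_geometric_of_lt_one (by positivity) hr).mul_right (Real.exp (k * t))⁻¹
  simp only [one_mul]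
  rw [Complex.hasSum_ofReal]
  have ev : (Real.exp (k * t) - 1)⁻¹
      = (1 - (Real.exp (k * t))⁻¹)⁻¹ * (Real.exp (k * t))⁻¹ := by
    have : Real.exp (k * t) - 1 ≠ 0 := by linarith
    have h2 : Real.exp (k * t) ≠ 0 := (Real.exp_pos _).ne'
    rw [← mul_inv]
    congr 1
    field_simp
  have hf : ∀ n : ℕ, Real.exp (-(k * (n + 1) : ℝ) * t)
      = (Real.exp (k * t))⁻¹ ^ n * (Real.exp (k * t))⁻¹ := fun n => by
    rw [← pow_succ, ← Real.exp_neg, ← Real.exp_nat_mul]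
    push_cast
    ring_nf
  rw [ev]
  simpa only [hf] using h

theorem mellin_inv_exp_sub_one {k : ℕ} (hk : 1 ≤ k) {s : ℂ} (hs : 1 < s.re) :
    mellin (fun t => (((Real.exp (k * t) - 1)⁻¹ : ℝ) : ℂ)) s
      = Complex.Gamma s * ((k : ℂ) ^ (-s) * riemannZeta s) := by
  have hk0 : (0 : ℝ) < k := by exact_mod_cast hk
  have e : ∀ n : ℕ, 1 / ((k * (n + 1) : ℝ) : ℂ) ^ s
      = (k : ℂ) ^ (-s) * (1 / ((n : ℂ) + 1) ^ s) := fun n => by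
    rw [Complex.ofReal_mul, Complex.mul_cpow_ofReal_nonneg hk0.le (by positivity),
      Complex.cpow_neg]
    push_cast
    field_simp
  have hz : Summable fun n : ℕ => 1 / ((n : ℂ) + 1) ^ s := by
    have := (summable_nat_add_iff 1).mpr (Complex.summable_one_div_nat_cpow.mpr hs)
    simpa using this
  have h3 : HasSum (fun n : ℕ => 1 / ((k * (n + 1) : ℝ) : ℂ) ^ s)
      ((k : ℂ) ^ (-s) * riemannZeta s) := by
    rw [zeta_eq_tsum_one_div_nat_add_one_cpow hs]
    simpa only [e] using hz.hasSum.mul_left _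
  have h4 := hasSum_mellin (a := fun _ : ℕ => (1 : ℂ)) (p := fun n : ℕ => (k * (n + 1) : ℝ))
    (F := fun t => (((Real.exp (k * t) - 1)⁻¹ : ℝ) : ℂ)) (s := s)
    (fun n => Or.inr (by positivity))
    (by linarith) (fun t ht => hasSum_exp_geometric hk ht)
    (by
      refine h3.summable.norm.congr fun n => ?_
      rw [norm_div, Complex.norm_cpow_eq_rpow_re_of_pos (by positivity)])
  refine h4.unique ?_
  simpa only [mul_div_assoc] using h3.mul_left (Complex.Gamma s)

/-! ### The edge kernel and the splitting of the logarithm -/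

/-- This is `u ≤ sinh u` at `u = y/2`, multiplied by `2 e^{y/2}`. It controls `1/(e^y - 1)` near `0`
and at infinity in a single bound. -/
lemma mul_exp_half_le_exp_sub_one {y : ℝ} (hy : 0 ≤ y) : y * Real.exp (y / 2) ≤ Real.exp y - 1 := by
  have h := Real.self_le_sinh_iff.mpr (by linarith : 0 ≤ y / 2)
  rw [Real.sinh_eq] at h
  have h0 := Real.exp_pos (y / 2)
  have h1 : Real.exp y = Real.exp (y / 2) * Real.exp (y / 2) := by rw [← Real.exp_add]; ring_nf
  have h2 : Real.exp (y / 2) * Real.exp (-(y / 2)) = 1 := by rw [← Real.exp_add]; simp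
  nlinarith

lemma inv_exp_sub_one_le {k : ℕ} (hk : 1 ≤ k) {t : ℝ} (ht : 0 < t) :
    (Real.exp (k * t) - 1)⁻¹ ≤ t⁻¹ * Real.exp (-(k / 2 : ℝ) * t) := by
  have hk1 : (1 : ℝ) ≤ k := by exact_mod_cast hk
  have h := mul_exp_half_le_exp_sub_one (by positivity : 0 ≤ k * t)
  have h1 : t * Real.exp (k * t / 2) ≤ Real.exp (k * t) - 1 := by
    refine le_trans ?_ h
    gcongr
    nlinarith
  calc _ ≤ (t * Real.exp (k * t / 2))⁻¹ := inv_anti₀ (by positivity) h1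
    _ = _ := by rw [mul_inv, ← Real.exp_neg]; ring_nf

lemma one_sub_exp_neg_pos {t : ℝ} (ht : 0 < t) : 0 < 1 - Real.exp (-t) := by
  simpa using ht

lemma exp_mul_sub_one_pos {k : ℕ} (hk : 1 ≤ k) {t : ℝ} (ht : 0 < t) :
    0 < Real.exp (k * t) - 1 := by
  have : 1 < Real.exp (k * t) := by rw [Real.one_lt_exp_iff]; positivity
  linarith

/-- The argument of the logarithm lies between `e^{-t}` and `1`. The resulting factor `t` cancels
the pole of `1/(e^{kt}-1)` at `0`. -/
lemma abs_log_one_sub_exp_neg_div_le {t : ℝ} (ht : 0 < t) :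
    |Real.log ((1 - Real.exp (-t)) / t)| ≤ t := by
  have h1 := one_sub_exp_neg_pos ht
  have hle : (1 - Real.exp (-t)) / t ≤ 1 := by
    rw [div_le_one ht]
    linarith [Real.add_one_le_exp (-t)]
  have hge : Real.exp (-t) ≤ (1 - Real.exp (-t)) / t := by
    rw [le_div_iff₀ ht]
    have h2 := Real.add_one_le_exp t
    have h3 : Real.exp t * Real.exp (-t) = 1 := by rw [← Real.exp_add]; simp
    nlinarith [Real.exp_pos (-t)]
  rw [abs_of_nonpos (Real.log_nonpos (by positivity) hle)]
  have := Real.log_le_log (Real.exp_pos _) hge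
  rw [Real.log_exp] at this
  linarith

/-- The kernel `log ((1 - e ^ (-t)) / t) / (e ^ (k t) - 1)`, which is the integrand of `hankelI` on
the edges of the cut, up to sign and the power of `t`. -/
noncomputable def edgeKernel (k : ℕ) (t : ℝ) : ℝ :=
  Real.log ((1 - Real.exp (-t)) / t) / (Real.exp (k * t) - 1)

lemma abs_edgeKernel_le {k : ℕ} (hk : 1 ≤ k) {t : ℝ} (ht : 0 < t) :
    |edgeKernel k t| ≤ Real.exp (-(k / 2 : ℝ) * t) := by
  have h := exp_mul_sub_one_pos hk ht
  rw [edgeKernel, abs_div, abs_of_pos h, div_eq_mul_inv]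
  calc _ ≤ t * (t⁻¹ * Real.exp (-(k / 2 : ℝ) * t)) :=
        mul_le_mul (abs_log_one_sub_exp_neg_div_le ht) (inv_exp_sub_one_le hk ht)
          (by positivity) ht.le
    _ = _ := by field_simp

lemma continuousOn_edgeKernel {k : ℕ} (hk : 1 ≤ k) :
    ContinuousOn (fun t => (edgeKernel k t : ℂ)) (Set.Ioi 0) := by
  refine Complex.continuous_ofReal.comp_continuousOn ?_
  refine ContinuousOn.div (ContinuousOn.log (ContinuousOn.div ?_ ?_ ?_) ?_) ?_ ?_
  · fun_prop
  · fun_prop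
  · exact fun t ht => ne_of_gt ht
  · exact fun t ht => (div_pos (one_sub_exp_neg_pos ht) ht).ne'
  · fun_prop
  · exact fun t ht => (exp_mul_sub_one_pos hk ht).ne'

lemma edgeKernel_isBigO_atTop {k : ℕ} (hk : 1 ≤ k) :
    (fun t => (edgeKernel k t : ℂ)) =O[atTop] fun t => Real.exp (-(k / 2 : ℝ) * t) := by
  refine Asymptotics.IsBigO.of_bound 1 ?_
  filter_upwards [eventually_gt_atTop 0] with t ht
  rw [one_mul, Complex.norm_real, Real.norm_eq_abs, Real.norm_of_nonneg (Real.exp_pos _).le]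
  exact abs_edgeKernel_le hk ht

lemma edgeKernel_isBigO_zero {k : ℕ} (hk : 1 ≤ k) :
    (fun t => (edgeKernel k t : ℂ)) =O[𝓝[>] 0] fun t : ℝ => t ^ (-0 : ℝ) := by
  refine Asymptotics.IsBigO.of_bound 1 ?_
  filter_upwards [self_mem_nhdsWithin] with t ht
  rw [Complex.norm_real, Real.norm_eq_abs, neg_zero, Real.rpow_zero, norm_one, one_mul]
  refine (abs_edgeKernel_le hk ht).trans (Real.exp_le_one_iff.mpr ?_)
  have ht : 0 < t := ht
  have : 0 ≤ (k : ℝ) / 2 * t := by positivity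
  linarith

lemma half_pos_of_one_le {k : ℕ} (hk : 1 ≤ k) : (0 : ℝ) < k / 2 := by
  have : (1 : ℝ) ≤ k := by exact_mod_cast hk
  positivity

lemma mellinConvergent_edgeKernel {k : ℕ} (hk : 1 ≤ k) {s : ℂ} (hs : 0 < s.re) :
    MellinConvergent (fun t => (edgeKernel k t : ℂ)) s :=
  mellinConvergent_of_isBigO_rpow_exp (half_pos_of_one_le hk)
    ((continuousOn_edgeKernel hk).locallyIntegrableOn measurableSet_Ioi)
    (edgeKernel_isBigO_atTop hk) (edgeKernel_isBigO_zero hk) hs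

lemma differentiableAt_mellin_edgeKernel {k : ℕ} (hk : 1 ≤ k) {s : ℂ} (hs : 0 < s.re) :
    DifferentiableAt ℂ (mellin (fun t => (edgeKernel k t : ℂ))) s :=
  mellin_differentiableAt_of_isBigO_rpow_exp (half_pos_of_one_le hk)
    ((continuousOn_edgeKernel hk).locallyIntegrableOn measurableSet_Ioi)
    (edgeKernel_isBigO_atTop hk) (edgeKernel_isBigO_zero hk) hs

/-- A factor `log t` amounts to differentiating `t^{s-1}` in `s` under the integral. The closed form
of the transform holds on an open half-plane, so it can be differentiated. -/
lemma mellin_log_smul_inv_exp_sub_one {k : ℕ} (hk : 1 ≤ k) {s : ℂ} (hs : 1 < s.re) :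
    HasMellin (fun t => Real.log t • (((Real.exp (k * t) - 1)⁻¹ : ℝ) : ℂ)) s
      (deriv (fun w => Complex.Gamma w * ((k : ℂ) ^ (-w) * riemannZeta w)) s) := by
  have hc : ContinuousOn (fun t : ℝ => (((Real.exp (k * t) - 1)⁻¹ : ℝ) : ℂ)) (Set.Ioi 0) :=
    Complex.continuous_ofReal.comp_continuousOn
      (ContinuousOn.inv₀ (by fun_prop) fun t ht => (exp_mul_sub_one_pos hk ht).ne')
  have htop : (fun t : ℝ => (((Real.exp (k * t) - 1)⁻¹ : ℝ) : ℂ)) =O[atTop]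
      fun t : ℝ => t ^ (-(s.re + 1)) := by
    refine Asymptotics.IsBigO.trans ?_
      (isLittleO_exp_neg_mul_rpow_atTop (half_pos_of_one_le hk) (-(s.re + 1))).isBigO
    refine Asymptotics.IsBigO.of_bound 1 ?_
    filter_upwards [eventually_ge_atTop 1] with t ht
    have ht0 : 0 < t := by linarith
    have h := exp_mul_sub_one_pos hk ht0
    rw [one_mul, Complex.norm_real, Real.norm_of_nonneg (by positivity),
      Real.norm_of_nonneg (Real.exp_pos _).le]
    refine (inv_exp_sub_one_le hk ht0).trans ?_
    exact mul_le_of_le_one_left (Real.exp_pos _).le (inv_le_one_of_one_le₀ ht)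
  have hbot : (fun t : ℝ => (((Real.exp (k * t) - 1)⁻¹ : ℝ) : ℂ)) =O[𝓝[>] 0]
      fun t : ℝ => t ^ (-1 : ℝ) := by
    refine Asymptotics.IsBigO.of_bound 1 ?_
    filter_upwards [self_mem_nhdsWithin] with t ht
    have ht : 0 < t := ht
    have h := exp_mul_sub_one_pos hk ht
    rw [one_mul, Complex.norm_real, Real.norm_of_nonneg (by positivity),
      Real.norm_of_nonneg (by positivity), Real.rpow_neg_one]
    refine (inv_exp_sub_one_le hk ht).trans ?_
    refine mul_le_of_le_one_right (by positivity) (Real.exp_le_one_iff.mpr ?_)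
    have : 0 ≤ (k : ℝ) / 2 * t := by positivity
    linarith
  have h := mellin_hasDerivAt_of_isBigO_rpow (hc.locallyIntegrableOn measurableSet_Ioi) htop
    (by linarith) hbot hs
  refine ⟨h.1, ?_⟩
  rw [← h.2.deriv]
  refine EventuallyEq.deriv_eq ?_
  filter_upwards [(isOpen_lt continuous_const Complex.continuous_re).mem_nhds hs] with w hw
  exact mellin_inv_exp_sub_one hk hw

theorem Gamma_mul_zetaA_sub {k : ℕ} (hk : 1 ≤ k) {s : ℂ} (hs : 1 < s.re) :
    Complex.Gamma s * (zetaA k s - riemannZeta (s + 1))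
      = -mellin (fun t => (edgeKernel k t : ℂ)) s
        - deriv (fun w => Complex.Gamma w * ((k : ℂ) ^ (-w) * riemannZeta w)) s := by
  have h1 := mellinConvergent_edgeKernel hk (by linarith : 0 < s.re)
  have h2 := mellin_log_smul_inv_exp_sub_one hk hs
  rw [← mellin_log_div hk hs, ← h2.2, ← neg_add', ← (hasMellin_add h1 h2.1).2]
  rw [← neg_one_smul ℂ, ← mellin_const_smul]
  refine setIntegral_congr_fun measurableSet_Ioi fun t ht => ?_
  have ht : 0 < t := ht
  simp only [edgeKernel, neg_smul, one_smul, Complex.real_smul]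
  rw [Real.log_div (one_sub_exp_neg_pos ht).ne' ht.ne']
  push_cast
  ring_nf

/-! ### The integrand on the contour -/

/-- Suppose `e^z - 1 = -u z` with `u ≥ 0` and `z = x + iy`. Then `e^x sin y = -u y`, but `sin y` has
the sign of `y` for `0 < |y| < π`. If `y = 0`, then `e^x - 1 = -u x`, but `e^x - 1` has the sign of
`x ≠ 0`. -/
lemma exp_sub_one_div_mem_slitPlane {z : ℂ} (h0 : z ≠ 0) (hz : |z.im| < Real.pi) :
    (Complex.exp z - 1) / z ∈ Complex.slitPlane := by
  rw [Complex.mem_slitPlane_iff_not_le_zero]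
  intro hle
  obtain ⟨u, hu, hu'⟩ : ∃ u : ℝ, 0 ≤ u ∧ (Complex.exp z - 1) / z = -u := by
    refine ⟨-((Complex.exp z - 1) / z).re, ?_, ?_⟩
    · simpa using (Complex.le_def.mp hle).1
    · have := (Complex.le_def.mp hle).2
      apply Complex.ext <;> simp at this ⊢
      exact this
  rw [div_eq_iff h0] at hu'
  have him := congrArg Complex.im hu'
  have hre := congrArg Complex.re hu'
  simp [Complex.exp_re, Complex.exp_im] at him hre
  have hE := Real.exp_pos z.re
  rcases lt_trichotomy z.im 0 with h | h | h
  · have hs : Real.sin z.im < 0 :=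
      Real.sin_neg_of_neg_of_neg_pi_lt h (by rw [abs_of_neg h] at hz; linarith)
    nlinarith
  · have hx : z.re ≠ 0 := fun hx => h0 (Complex.ext hx h)
    rw [h, Real.cos_zero, mul_one] at hre
    rcases lt_or_gt_of_ne hx with hx | hx
    · have := Real.exp_lt_one_iff.mpr hx
      nlinarith
    · have := Real.one_lt_exp_iff.mpr hx
      nlinarith
  · have hs : 0 < Real.sin z.im :=
      Real.sin_pos_of_pos_of_lt_pi h (by rwa [abs_of_pos h] at hz)
    nlinarith

lemma exp_nat_mul_ne_one {k : ℕ} (hk : 1 ≤ k) {z : ℂ} (h0 : z ≠ 0)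
    (hz : k * ‖z‖ < 2 * Real.pi) : Complex.exp (k * z) ≠ 1 := by
  intro h
  obtain ⟨n, hn⟩ := Complex.exp_eq_one_iff.mp h
  have h1 : (k : ℝ) * ‖z‖ = |(n : ℝ)| * (2 * Real.pi) := by
    have := congrArg norm hn
    simpa [abs_of_pos Real.pi_pos] using this
  have hn0 : n ≠ 0 := by
    rintro rfl
    simp [h0] at hn
    omega
  have h2 : (1 : ℝ) ≤ |(n : ℝ)| := by exact_mod_cast Int.one_le_abs hn0
  nlinarith [Real.pi_pos]

/-- The factor of the integrand of `hankelI` that does not depend on the branch. -/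
noncomputable def kernel (k : ℕ) (z : ℂ) : ℂ :=
  (Complex.exp (k * z) / (Complex.exp (k * z) - 1)) * Complex.log ((Complex.exp z - 1) / z)

lemma differentiableAt_kernel {k : ℕ} (hk : 1 ≤ k) {z : ℂ} (h0 : z ≠ 0) (h1 : ‖z‖ < Real.pi)
    (h2 : k * ‖z‖ < 2 * Real.pi) : DifferentiableAt ℂ (kernel k) z := by
  refine DifferentiableAt.mul (DifferentiableAt.div (by fun_prop) (by fun_prop)
    (sub_ne_zero.mpr (exp_nat_mul_ne_one hk h0 h2))) (DifferentiableAt.clog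
      (DifferentiableAt.div (by fun_prop) (by fun_prop) h0) ?_)
  exact exp_sub_one_div_mem_slitPlane h0 (lt_of_le_of_lt (Complex.abs_im_le_norm z) h1)

/-- The simple pole of `1/(e^{kz}-1)` meets the zero of `log((e^z-1)/z)`. Dividing both by `z`,
through `dslope`, leaves a continuous quotient. This bounds the kernel on small circles. -/
lemma tendsto_kernel_zero {k : ℕ} (hk : 1 ≤ k) : ∃ c, Tendsto (kernel k) (𝓝[≠] 0) (𝓝 c) := by
  set q : ℂ → ℂ := dslope Complex.exp 0 with hq
  have hq0 : q 0 = 1 := by simp [hq, dslope_same]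
  have hqd : DifferentiableAt ℂ q 0 :=
    ((Complex.differentiableOn_dslope univ_mem).mpr
      Complex.differentiable_exp.differentiableOn).differentiableAt univ_mem
  set l : ℂ → ℂ := fun z => Complex.log (q z) with hl
  have hld : DifferentiableAt ℂ l 0 := hqd.clog (by rw [hq0]; simp)
  have hl0 : l 0 = 0 := by simp [hl, hq0]
  set e : ℂ → ℂ := fun z => Complex.exp (k * z) with he
  have hed : DifferentiableAt ℂ e 0 := by fun_prop
  have hder : dslope e 0 0 ≠ 0 := by
    have : HasDerivAt e (Complex.exp (k * 0) * (k * 1)) 0 :=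
      ((hasDerivAt_id (0 : ℂ)).const_mul (k : ℂ)).cexp
    rw [dslope_same, this.deriv]
    simp
    omega
  have hc : ContinuousAt (fun z => e z * (dslope e 0 z)⁻¹ * dslope l 0 z) 0 :=
    (hed.continuousAt.mul ((continuousAt_dslope_same.mpr hed).inv₀ hder)).mul
      (continuousAt_dslope_same.mpr hld)
  refine ⟨_, (hc.tendsto.mono_left nhdsWithin_le_nhds).congr' ?_⟩
  filter_upwards [self_mem_nhdsWithin] with z hz
  have hz : z ≠ 0 := hz
  rw [dslope_of_ne _ hz, dslope_of_ne _ hz, slope_def_field, slope_def_field, hl0]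
  have : l z = Complex.log ((Complex.exp z - 1) / z) := by
    simp only [hl, hq]
    rw [dslope_of_ne _ hz, slope_def_field]
    simp
  rw [this, kernel]
  simp only [he, mul_zero, Complex.exp_zero, sub_zero]
  field_simp

lemma hankelIntegrand_eq (k : ℕ) (s : ℂ) (r θ : ℝ) :
    hankelIntegrand k s r θ = Complex.exp ((s - 1) * (Real.log r + θ * Complex.I)) *
      kernel k (r * Complex.exp (θ * Complex.I)) := by
  simp only [hankelIntegrand, kernel]
  ring

/-- At `z = -x` the kernel becomes `-edgeKernel`, so the two edges differ only in the phase of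
`z^{s-1}`. -/
lemma hankelIntegrand_edge (k : ℕ) (s : ℂ) {x θ : ℝ} (hx : 0 < x)
    (hθ : Complex.exp (θ * Complex.I) = -1) :
    hankelIntegrand k s x θ = -Complex.exp ((s - 1) * (θ * Complex.I)) *
      ((x : ℂ) ^ (s - 1) • (edgeKernel k x : ℂ)) := by
  have hx0 : (x : ℂ) ≠ 0 := by exact_mod_cast hx.ne'
  have h1 := one_sub_exp_neg_pos hx
  have e1 : (Complex.exp (x * -1) - 1) / (x * -1) = (((1 - Real.exp (-x)) / x : ℝ) : ℂ) := by
    push_cast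
    rw [mul_neg_one]
    field_simp
    ring
  have e2 : Complex.exp (k * (x * -1)) / (Complex.exp (k * (x * -1)) - 1)
      = -(((Real.exp (k * x) - 1)⁻¹ : ℝ) : ℂ) := by
    push_cast
    rw [show (k : ℂ) * (x * -1) = -(k * x) by ring, Complex.exp_neg]
    have hE := Complex.exp_ne_zero ((k : ℂ) * x)
    generalize Complex.exp ((k : ℂ) * x) = E at hE
    have h4 : E⁻¹ - 1 = -(E - 1) / E := by field_simp; ring
    rw [h4, div_div_eq_mul_div, inv_mul_cancel₀ hE, one_div, inv_neg]
  rw [hankelIntegrand_eq, hθ, kernel, e1, e2, ← Complex.ofReal_log (by positivity), mul_add,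
    Complex.exp_add, Complex.cpow_def_of_ne_zero hx0, ← Complex.ofReal_log hx.le, edgeKernel]
  push_cast
  simp only [smul_eq_mul]
  ring_nf

lemma exp_neg_pi_mul_I : Complex.exp ((-Real.pi : ℝ) * Complex.I) = -1 := by
  rw [Complex.ofReal_neg, neg_mul, Complex.exp_neg, Complex.exp_pi_mul_I]
  norm_num

lemma integrableOn_edgeKernel {k : ℕ} (hk : 1 ≤ k) :
    IntegrableOn (fun t => (edgeKernel k t : ℂ)) (Set.Ioi 0) := by
  have := mellinConvergent_edgeKernel hk (s := 1) (by simp)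
  simpa [MellinConvergent] using this

/-! ### Convergence and entireness of the Hankel integral -/

/-- `edgeKernel` cut off to `t > ε`, whose Mellin transform is entire. -/
noncomputable def cutKernel (k : ℕ) (ε : ℝ) : ℝ → ℂ :=
  (Set.Ioi ε).indicator fun t => (edgeKernel k t : ℂ)

lemma cutKernel_locallyIntegrableOn {k : ℕ} (hk : 1 ≤ k) (ε : ℝ) :
    LocallyIntegrableOn (cutKernel k ε) (Set.Ioi 0) :=
  ((integrableOn_edgeKernel hk).indicator measurableSet_Ioi).locallyIntegrableOn

lemma cutKernel_isBigO_atTop {k : ℕ} (hk : 1 ≤ k) (ε : ℝ) :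
    cutKernel k ε =O[atTop] fun t => Real.exp (-(k / 2 : ℝ) * t) := by
  refine (edgeKernel_isBigO_atTop hk).congr' ?_ EventuallyEq.rfl
  filter_upwards [eventually_gt_atTop ε] with t ht
  rw [cutKernel, Set.indicator_of_mem (Set.mem_Ioi.mpr ht)]

/-- The cut-off function vanishes near `0`, so `b` is arbitrary. Taking `b < re s` removes any
restriction on `s`. -/
lemma cutKernel_isBigO_zero (k : ℕ) {ε : ℝ} (hε : 0 < ε) (b : ℝ) :
    cutKernel k ε =O[𝓝[>] 0] fun t : ℝ => t ^ (-b) := by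
  refine (Asymptotics.isBigO_zero (E' := ℂ) _ _).congr' ?_ EventuallyEq.rfl
  filter_upwards [mem_nhdsWithin_of_mem_nhds (Iio_mem_nhds hε)] with t ht
  rw [cutKernel, Set.indicator_of_notMem (Set.notMem_Ioi.mpr (le_of_lt ht))]

lemma mellinConvergent_cutKernel {k : ℕ} (hk : 1 ≤ k) {ε : ℝ} (hε : 0 < ε) (s : ℂ) :
    MellinConvergent (cutKernel k ε) s :=
  mellinConvergent_of_isBigO_rpow_exp (half_pos_of_one_le hk) (cutKernel_locallyIntegrableOn hk ε)
    (cutKernel_isBigO_atTop hk ε) (cutKernel_isBigO_zero k hε (s.re - 1)) (by linarith)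

lemma differentiable_mellin_cutKernel {k : ℕ} (hk : 1 ≤ k) {ε : ℝ} (hε : 0 < ε) :
    Differentiable ℂ (mellin (cutKernel k ε)) := fun s =>
  mellin_differentiableAt_of_isBigO_rpow_exp (half_pos_of_one_le hk)
    (cutKernel_locallyIntegrableOn hk ε)
    (cutKernel_isBigO_atTop hk ε) (cutKernel_isBigO_zero k hε (s.re - 1)) (by linarith)

lemma cutKernel_smul (k : ℕ) (ε : ℝ) (s : ℂ) :
    (fun t : ℝ => (t : ℂ) ^ (s - 1) • cutKernel k ε t)
      = (Set.Ioi ε).indicator fun t : ℝ => (t : ℂ) ^ (s - 1) • (edgeKernel k t : ℂ) := by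
  ext t
  simp only [cutKernel, Set.indicator_apply]
  split_ifs <;> simp

lemma integrableOn_cpow_smul_edgeKernel {k : ℕ} (hk : 1 ≤ k) {ε : ℝ} (hε : 0 < ε) (s : ℂ) :
    IntegrableOn (fun t : ℝ => (t : ℂ) ^ (s - 1) • (edgeKernel k t : ℂ)) (Set.Ioi ε) := by
  have h := mellinConvergent_cutKernel hk hε s
  rw [MellinConvergent, cutKernel_smul, integrableOn_indicator_iff measurableSet_Ioi] at h
  rwa [Set.inter_eq_left.mpr (Set.Ioi_subset_Ioi hε.le)] at h

lemma mellin_cutKernel (k : ℕ) {ε : ℝ} (hε : 0 < ε) (s : ℂ) :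
    mellin (cutKernel k ε) s
      = ∫ t in Set.Ioi ε, (t : ℂ) ^ (s - 1) • (edgeKernel k t : ℂ) := by
  rw [mellin, cutKernel_smul, setIntegral_indicator measurableSet_Ioi,
    Set.inter_eq_right.mpr (Set.Ioi_subset_Ioi hε.le)]

lemma integrableOn_edge {k : ℕ} (hk : 1 ≤ k) {ε : ℝ} (hε : 0 < ε) (s : ℂ) {θ : ℝ}
    (hθ : Complex.exp (θ * Complex.I) = -1) :
    IntegrableOn (fun x => hankelIntegrand k s x θ) (Set.Ioi ε) := by
  refine IntegrableOn.congr_fun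
    
    ((integrableOn_cpow_smul_edgeKernel hk hε s).const_mul
      (-Complex.exp ((s - 1) * (θ * Complex.I)))) (fun x hx => ?_) measurableSet_Ioi
  exact (hankelIntegrand_edge k s (hε.trans hx) hθ).symm

lemma integral_edge (k : ℕ) {ε : ℝ} (hε : 0 ≤ ε) (s : ℂ) {θ : ℝ}
    (hθ : Complex.exp (θ * Complex.I) = -1) :
    ∫ x in Set.Ioi ε, hankelIntegrand k s x θ = -Complex.exp ((s - 1) * (θ * Complex.I)) *
      ∫ t in Set.Ioi ε, (t : ℂ) ^ (s - 1) • (edgeKernel k t : ℂ) := by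
  rw [← integral_const_mul]
  refine setIntegral_congr_fun measurableSet_Ioi fun x hx => ?_
  exact hankelIntegrand_edge k s (lt_of_le_of_lt hε hx) hθ

lemma differentiable_edge {k : ℕ} (hk : 1 ≤ k) {ε : ℝ} (hε : 0 < ε) {θ : ℝ}
    (hθ : Complex.exp (θ * Complex.I) = -1) :
    Differentiable ℂ fun s => ∫ x in Set.Ioi ε, hankelIntegrand k s x θ := by
  simp_rw [integral_edge k hε.le _ hθ, ← mellin_cutKernel k hε]
  have := differentiable_mellin_cutKernel hk hε
  fun_prop

lemma norm_ofReal_mul_exp {r : ℝ} (hr : 0 < r) (θ : ℝ) :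
    ‖(r : ℂ) * Complex.exp (θ * Complex.I)‖ = r := by
  rw [norm_mul, Complex.norm_exp_ofReal_mul_I, mul_one, Complex.norm_real,
    Real.norm_of_nonneg hr.le]

lemma continuous_kernel_circle {k : ℕ} (hk : 1 ≤ k) {ε : ℝ} (hε : 0 < ε) (h1 : ε < Real.pi)
    (h2 : k * ε < 2 * Real.pi) :
    Continuous fun θ : ℝ => kernel k (ε * Complex.exp (θ * Complex.I)) := by
  refine continuous_iff_continuousAt.mpr fun θ => ?_
  have hn := norm_ofReal_mul_exp hε θ
  refine ContinuousAt.comp (g := kernel k)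
    (differentiableAt_kernel hk (norm_pos_iff.mp (by rwa [hn])) (by rwa [hn])
      (by rwa [hn])).continuousAt ?_
  fun_prop

/-- A parametric integral of exponentials is entire in the parameter. -/
lemma differentiable_integral_exp_mul {c g : ℝ → ℂ} (hc : Continuous c) (hg : Continuous g)
    (a b : ℝ) : Differentiable ℂ fun s : ℂ => ∫ θ in a..b, Complex.exp (s * c θ) * g θ := by
  intro s₀
  have h := intervalIntegral.hasDerivAt_integral_of_dominated_loc_of_deriv_le (μ := volume)
    (a := a) (b := b) (F := fun s θ => Complex.exp (s * c θ) * g θ)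
    (F' := fun s θ => Complex.exp (s * c θ) * c θ * g θ)
    -- On the unit ball around `s₀`, `‖s‖ ≤ ‖s₀‖ + 1`.
    (bound := fun θ => Real.exp ((‖s₀‖ + 1) * ‖c θ‖) * ‖c θ‖ * ‖g θ‖)
    (x₀ := s₀) (s := Metric.ball s₀ 1) (Metric.ball_mem_nhds s₀ one_pos)
    (Eventually.of_forall fun s => by
      exact (by fun_prop : Continuous fun θ => Complex.exp (s * c θ) * g θ).aestronglyMeasurable)
    ((by fun_prop : Continuous fun θ => Complex.exp (s₀ * c θ) * g θ).intervalIntegrable a b)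
    (by
      exact (by fun_prop :
        Continuous fun θ => Complex.exp (s₀ * c θ) * c θ * g θ).aestronglyMeasurable)
    (Eventually.of_forall fun θ _ s hs => by
      rw [norm_mul, norm_mul, Complex.norm_exp]
      gcongr
      refine (Complex.re_le_norm _).trans ?_
      rw [norm_mul]
      gcongr
      have := norm_sub_norm_le s s₀
      rw [Metric.mem_ball, dist_eq_norm] at hs
      linarith)
    ((by fun_prop : Continuous fun θ =>
      Real.exp ((‖s₀‖ + 1) * ‖c θ‖) * ‖c θ‖ * ‖g θ‖).intervalIntegrable a b)
    (Eventually.of_forall fun θ _ s _ => by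
      simpa using (((hasDerivAt_id s).mul_const (c θ)).cexp).mul_const (g θ))
  exact h.2.differentiableAt

lemma hankelIntegrand_circle (k : ℕ) (s : ℂ) (ε θ : ℝ) :
    hankelIntegrand k s ε θ * (Complex.I * ε * Complex.exp (θ * Complex.I))
      = Complex.exp (s * (Real.log ε + θ * Complex.I)) *
        (Complex.exp (-(Real.log ε + θ * Complex.I)) * kernel k (ε * Complex.exp (θ * Complex.I)) *
          (Complex.I * ε * Complex.exp (θ * Complex.I))) := by
  rw [hankelIntegrand_eq, sub_mul, one_mul, sub_eq_add_neg, Complex.exp_add]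
  ring

theorem hankelConverges {k : ℕ} (hk : 1 ≤ k) {ε : ℝ} (hε : 0 < ε) (h1 : ε < Real.pi)
    (h2 : k * ε < 2 * Real.pi) (s : ℂ) : HankelConverges k ε s := by
  refine ⟨integrableOn_edge hk hε s exp_neg_pi_mul_I, ?_,
    integrableOn_edge hk hε s Complex.exp_pi_mul_I⟩
  have := continuous_kernel_circle hk hε h1 h2
  simp_rw [hankelIntegrand_circle]
  exact Continuous.intervalIntegrable (by fun_prop) _ _

theorem differentiable_hankelI {k : ℕ} (hk : 1 ≤ k) {ε : ℝ} (hε : 0 < ε) (h1 : ε < Real.pi)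
    (h2 : k * ε < 2 * Real.pi) : Differentiable ℂ (hankelI k ε) := by
  have hcont := continuous_kernel_circle hk hε h1 h2
  have hcirc : Differentiable ℂ fun s => ∫ θ in (-Real.pi)..Real.pi,
      hankelIntegrand k s ε θ * (Complex.I * ε * Complex.exp (θ * Complex.I)) := by
    simp_rw [hankelIntegrand_circle]
    exact differentiable_integral_exp_mul (by fun_prop) (by fun_prop) _ _
  unfold hankelI
  exact (((differentiable_edge hk hε exp_neg_pi_mul_I).add hcirc).sub
    (differentiable_edge hk hε Complex.exp_pi_mul_I)).const_mul _

/-! ### Independence of the radius -/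

/-- The integral of `hankelIntegrand` over the circle of radius `ε`. -/
noncomputable def circlePart (k : ℕ) (s : ℂ) (ε : ℝ) : ℂ :=
  ∫ θ in (-Real.pi)..Real.pi,
    hankelIntegrand k s ε θ * (Complex.I * ε * Complex.exp (θ * Complex.I))

/-- The integrand of `hankelI` in the coordinate `w = log z`. -/
noncomputable def logIntegrand (k : ℕ) (s w : ℂ) : ℂ :=
  Complex.exp ((s - 1) * w) * kernel k (Complex.exp w) * Complex.exp w

lemma exp_log_add {r : ℝ} (hr : 0 < r) (θ : ℝ) :
    Complex.exp (Real.log r + θ * Complex.I) = r * Complex.exp (θ * Complex.I) := by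
  rw [Complex.exp_add, ← Complex.ofReal_exp, Real.exp_log hr]

lemma logIntegrand_log_add (k : ℕ) (s : ℂ) {r : ℝ} (hr : 0 < r) (θ : ℝ) :
    logIntegrand k s (Real.log r + θ * Complex.I)
      = hankelIntegrand k s r θ * (r * Complex.exp (θ * Complex.I)) := by
  rw [logIntegrand, exp_log_add hr, hankelIntegrand_eq]

lemma differentiableAt_logIntegrand {k : ℕ} (hk : 1 ≤ k) (s : ℂ) {w : ℂ}
    (h1 : Real.exp w.re < Real.pi) (h2 : k * Real.exp w.re < 2 * Real.pi) :
    DifferentiableAt ℂ (logIntegrand k s) w := by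
  have hn : ‖Complex.exp w‖ = Real.exp w.re := Complex.norm_exp w
  refine DifferentiableAt.mul (DifferentiableAt.mul (by fun_prop) ?_) (by fun_prop)
  exact (differentiableAt_kernel hk (Complex.exp_ne_zero w) (by rwa [hn]) (by rwa [hn])).comp w
    (by fun_prop)

lemma circlePart_eq (k : ℕ) (s : ℂ) {r : ℝ} (hr : 0 < r) :
    circlePart k s r = Complex.I • ∫ θ in (-Real.pi)..Real.pi,
      logIntegrand k s (Real.log r + θ * Complex.I) := by
  rw [circlePart, ← intervalIntegral.integral_smul]
  refine intervalIntegral.integral_congr fun θ _ => ?_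
  simp only [logIntegrand_log_add k s hr, smul_eq_mul]
  ring

/-- Substitute `e^x` for the radius; the sign is that of `dz = -dx` on the cut. -/
lemma integral_logIntegrand_edge {k : ℕ} (hk : 1 ≤ k) (s : ℂ) {δ ε : ℝ} (hδ : 0 < δ) (hε : 0 < ε)
    {θ : ℝ} (hθ : Complex.exp (θ * Complex.I) = -1) :
    ∫ x in Real.log δ..Real.log ε, logIntegrand k s (x + θ * Complex.I)
      = -∫ x in δ..ε, hankelIntegrand k s x θ := by
  have hcont : ContinuousOn (fun x => hankelIntegrand k s x θ) (Set.Ioi 0) := by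
    have h : ContinuousOn (fun x : ℝ => -Complex.exp ((s - 1) * (θ * Complex.I)) *
        ((x : ℂ) ^ (s - 1) • (edgeKernel k x : ℂ))) (Set.Ioi 0) := by
      simp only [smul_eq_mul]
      refine continuousOn_const.mul (ContinuousOn.mul (fun x hx => ?_)
        (continuousOn_edgeKernel hk))
      exact ((Complex.continuous_ofReal.continuousAt).cpow continuousAt_const
        (Complex.ofReal_mem_slitPlane.mpr hx)).continuousWithinAt
    exact h.congr fun x hx => hankelIntegrand_edge k s hx hθ
  have h := intervalIntegral.integral_deriv_smul_comp' (a := Real.log δ) (b := Real.log ε)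
    (f := Real.exp) (f' := Real.exp) (g := fun x => hankelIntegrand k s x θ)
    (fun x _ => Real.hasDerivAt_exp x) Real.continuous_exp.continuousOn
    (hcont.mono (by rintro _ ⟨x, _, rfl⟩; exact Real.exp_pos x))
  rw [Real.exp_log hδ, Real.exp_log hε] at h
  rw [← h, ← intervalIntegral.integral_neg]
  refine intervalIntegral.integral_congr fun x _ => ?_
  have := logIntegrand_log_add k s (Real.exp_pos x) θ
  rw [Real.log_exp] at this
  simp only [this, hθ, Function.comp, Complex.real_smul]
  ring

/-- In the coordinate `w = log z` the slit annulus is a rectangle: the circles are its vertical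
sides, the edges of the cut its horizontal ones. There `z^{s-1}` is single-valued and the integrand
is holomorphic up to the boundary, so Cauchy's theorem for rectangles applies. -/
theorem hankelI_eq_of_le {k : ℕ} (hk : 1 ≤ k) {δ ε : ℝ} (hδ : 0 < δ) (hδε : δ ≤ ε)
    (h1 : ε < Real.pi) (h2 : k * ε < 2 * Real.pi) (s : ℂ) :
    hankelI k δ s = hankelI k ε s := by
  have hε : 0 < ε := hδ.trans_le hδε
  have hrect := Complex.integral_boundary_rect_eq_zero_of_differentiableOn (logIntegrand k s)
    (Real.log δ + (-Real.pi : ℝ) * Complex.I) (Real.log ε + Real.pi * Complex.I) (fun w hw => by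
      have hw := hw.1
      simp only [Set.mem_preimage, Complex.add_re, Complex.ofReal_re, Complex.mul_re,
        Complex.I_re, mul_zero, Complex.ofReal_im, Complex.I_im, zero_mul, sub_zero, add_zero] at hw
      rw [Set.uIcc_of_le (Real.log_le_log hδ hδε)] at hw
      have hle : Real.exp w.re ≤ ε := by
        rw [← Real.exp_log hε]
        exact Real.exp_le_exp.mpr hw.2
      refine (differentiableAt_logIntegrand hk s (hle.trans_lt h1)
        (lt_of_le_of_lt ?_ h2)).differentiableWithinAt
      gcongr)
  simp only [Complex.add_re, Complex.add_im, Complex.ofReal_re, Complex.mul_re, Complex.mul_im,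
    Complex.I_re, mul_zero, Complex.ofReal_im, Complex.I_im, sub_zero, add_zero,
    zero_add, mul_one] at hrect
  rw [← circlePart_eq k s hδ, ← circlePart_eq k s hε,
    integral_logIntegrand_edge hk s hδ hε exp_neg_pi_mul_I,
    integral_logIntegrand_edge hk s hδ hε Complex.exp_pi_mul_I] at hrect
  have hlow := intervalIntegral.integral_Ioi_sub_Ioi
    (integrableOn_edge hk hδ s exp_neg_pi_mul_I) hδε
  have hup := intervalIntegral.integral_Ioi_sub_Ioi
    (integrableOn_edge hk hδ s Complex.exp_pi_mul_I) hδε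
  rw [hankelI, hankelI]
  congr 1
  change _ + circlePart k s δ - _ = _ + circlePart k s ε - _
  linear_combination hlow - hup - hrect

theorem hankelI_eq {k : ℕ} (hk : 1 ≤ k) {δ ε : ℝ} (hδ : 0 < δ) (hδ1 : δ < Real.pi)
    (hδ2 : k * δ < 2 * Real.pi) (hε : 0 < ε) (h1 : ε < Real.pi) (h2 : k * ε < 2 * Real.pi) :
    hankelI k δ = hankelI k ε := by
  ext s
  rcases le_total δ ε with h | h
  · exact hankelI_eq_of_le hk hδ h h1 h2 s
  · exact (hankelI_eq_of_le hk hε h hδ1 hδ2 s).symm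

/-! ### Collapsing the contour onto the cut -/

/-- The kernel is bounded near `0` and `|z^{s-1}| r ≤ e^{π |im s|} r^{re s}`, so the integral is
`O(r^{re s})`. -/
lemma tendsto_circlePart {k : ℕ} (hk : 1 ≤ k) {s : ℂ} (hs : 0 < s.re) :
    Tendsto (circlePart k s) (𝓝[>] 0) (𝓝 0) := by
  obtain ⟨c, hc⟩ := tendsto_kernel_zero hk
  have hb : ∀ᶠ z in 𝓝[≠] (0 : ℂ), ‖kernel k z‖ ≤ ‖c‖ + 1 :=
    hc.norm.eventually_le_const (by linarith)
  rw [eventually_nhdsWithin_iff, Metric.eventually_nhds_iff] at hb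
  obtain ⟨ρ, hρ, hb⟩ := hb
  set B : ℝ := Real.exp (|s.im| * Real.pi) * (‖c‖ + 1) * (2 * Real.pi) with hB
  have hbound : ∀ᶠ r in 𝓝[>] (0 : ℝ), ‖circlePart k s r‖ ≤ B * r ^ s.re := by
    filter_upwards [Ioo_mem_nhdsGT hρ] with r hr
    have hr0 : 0 < r := hr.1
    have h : ‖circlePart k s r‖ ≤
        (Real.exp (|s.im| * Real.pi) * (‖c‖ + 1) * r ^ s.re) * |Real.pi - -Real.pi| := by
      refine intervalIntegral.norm_integral_le_of_norm_le_const fun θ hθ => ?_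
      rw [Set.uIoc_of_le (by linarith [Real.pi_pos])] at hθ
      have hn := norm_ofReal_mul_exp hr0 θ
      have hk1 : ‖kernel k (r * Complex.exp (θ * Complex.I))‖ ≤ ‖c‖ + 1 := by
        refine hb (by rw [dist_zero_right, hn]; exact hr.2) ?_
        exact norm_pos_iff.mp (by rwa [hn])
      have he : ‖Complex.exp ((s - 1) * (Real.log r + θ * Complex.I))‖ * r
          ≤ Real.exp (|s.im| * Real.pi) * r ^ s.re := by
        rw [Complex.norm_exp, Real.rpow_def_of_pos hr0]
        nth_rewrite 2 [← Real.exp_log hr0]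
        rw [← Real.exp_add, ← Real.exp_add, Real.exp_le_exp]
        have h3 : -(s.im * θ) ≤ |s.im| * Real.pi := by
          refine (neg_le_abs _).trans ?_
          rw [abs_mul]
          gcongr
          exact abs_le.mpr ⟨hθ.1.le, hθ.2⟩
        simp
        linarith
      rw [hankelIntegrand_eq, mul_assoc Complex.I, norm_mul, norm_mul, norm_mul Complex.I, hn,
        Complex.norm_I, one_mul]
      calc _ = (‖Complex.exp ((s - 1) * (Real.log r + θ * Complex.I))‖ * r)
            * ‖kernel k (r * Complex.exp (θ * Complex.I))‖ := by ring
        _ ≤ (Real.exp (|s.im| * Real.pi) * r ^ s.re) * (‖c‖ + 1) := by gcongr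
        _ = _ := by ring
    refine h.trans (le_of_eq ?_)
    rw [abs_of_pos (show 0 < Real.pi - -Real.pi by linarith [Real.pi_pos]), hB]
    ring
  refine squeeze_zero_norm' hbound ?_
  have h0 : Tendsto (fun r : ℝ => B * r ^ s.re) (𝓝 0) (𝓝 (B * (0 : ℝ) ^ s.re)) :=
    ((Real.continuousAt_rpow_const 0 s.re (Or.inr hs.le)).tendsto).const_mul B
  rw [Real.zero_rpow hs.ne', mul_zero] at h0
  exact h0.mono_left nhdsWithin_le_nhds

lemma tendsto_integral_edge {k : ℕ} (hk : 1 ≤ k) {s : ℂ} (hs : 0 < s.re) {θ : ℝ}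
    (hθ : Complex.exp (θ * Complex.I) = -1) :
    Tendsto (fun δ : ℝ => ∫ x in Set.Ioi δ, hankelIntegrand k s x θ) (𝓝[>] 0)
      (𝓝 (-Complex.exp ((s - 1) * (θ * Complex.I)) *
        mellin (fun t => (edgeKernel k t : ℂ)) s)) := by
  have hcov : AECover (volume.restrict (Set.Ioi (0 : ℝ))) (𝓝[>] (0 : ℝ)) fun δ => Set.Ioi δ :=
    aecover_Ioi_of_Ioi (a := fun δ : ℝ => δ) (tendsto_id.mono_left nhdsWithin_le_nhds)
  have h := (hcov.integral_tendsto_of_countably_generated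
    (mellinConvergent_edgeKernel hk hs)).const_mul (-Complex.exp ((s - 1) * (θ * Complex.I)))
  refine h.congr' ?_
  filter_upwards [self_mem_nhdsWithin] with δ hδ
  have hδ : 0 < δ := hδ
  rw [integral_edge k hδ.le s hθ, Measure.restrict_restrict measurableSet_Ioi,
    Set.inter_eq_left.mpr (Set.Ioi_subset_Ioi hδ.le)]

/-- The integral is constant in the radius, so it equals its limit as the radius tends to `0`. The
circle disappears and the phases `e^{∓iπ(s-1)}` of the edges combine into the sine. -/
theorem hankelI_eq_mellin {k : ℕ} (hk : 1 ≤ k) {ε : ℝ} (hε : 0 < ε) (h1 : ε < Real.pi)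
    (h2 : k * ε < 2 * Real.pi) {s : ℂ} (hs : 0 < s.re) :
    hankelI k ε s = -(Complex.sin (Real.pi * s) / Real.pi) *
      mellin (fun t => (edgeKernel k t : ℂ)) s := by
  have hpi : (Real.pi : ℂ) ≠ 0 := by exact_mod_cast Real.pi_ne_zero
  have hlim := (((tendsto_integral_edge hk hs exp_neg_pi_mul_I).add
    (tendsto_circlePart hk hs)).sub
      (tendsto_integral_edge hk hs Complex.exp_pi_mul_I)).const_mul
        (1 / (2 * Real.pi * Complex.I))
  have hconst : Tendsto (fun _ : ℝ => hankelI k ε s) (𝓝[>] 0) (𝓝 (hankelI k ε s)) :=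
    tendsto_const_nhds
  have heq : (fun δ : ℝ => (1 / (2 * Real.pi * Complex.I)) *
      ((∫ x in Set.Ioi δ, hankelIntegrand k s x (-Real.pi)) + circlePart k s δ
        - ∫ x in Set.Ioi δ, hankelIntegrand k s x Real.pi)) =ᶠ[𝓝[>] 0]
      fun _ => hankelI k ε s := by
    filter_upwards [Ioo_mem_nhdsGT hε] with δ hδ
    exact hankelI_eq_of_le hk hδ.1 hδ.2.le h1 h2 s
  have := tendsto_nhds_unique (hconst.congr' heq.symm) hlim
  rw [this, Complex.sin]
  have e1 : Complex.exp ((s - 1) * ((-Real.pi : ℝ) * Complex.I))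
      = -Complex.exp (-(Real.pi * s) * Complex.I) := by
    rw [show (s - 1) * ((-Real.pi : ℝ) * Complex.I)
      = -(Real.pi * s) * Complex.I + Real.pi * Complex.I by push_cast; ring, Complex.exp_add,
      Complex.exp_pi_mul_I]
    ring
  have e2 : Complex.exp ((s - 1) * (Real.pi * Complex.I))
      = -Complex.exp (Real.pi * s * Complex.I) := by
    rw [show (s - 1) * (Real.pi * Complex.I)
      = Real.pi * s * Complex.I + (-Real.pi : ℝ) * Complex.I by push_cast; ring, Complex.exp_add,
      exp_neg_pi_mul_I]
    ring
  rw [e1, e2]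
  field_simp
  ring_nf
  simp only [Complex.I_sq]
  ring

/-! ### Calculus of principal parts -/

lemma exists_analyticAt_eq_add_mul {h : ℂ → ℂ} {a : ℂ} (hh : AnalyticAt ℂ h a) :
    ∃ p : ℂ → ℂ, AnalyticAt ℂ p a ∧ p a = deriv h a ∧ ∀ z, h z = h a + (z - a) * p z := by
  refine ⟨dslope h a, ?_, dslope_same h a, fun z => ?_⟩
  · obtain ⟨q, hq⟩ := hh
    exact ⟨_, hq.has_fpower_series_dslope_fslope⟩
  · have := sub_smul_dslope h a z
    rw [smul_eq_mul] at this
    rw [this]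
    ring

namespace HasPrincipalPart

variable {f g : ℂ → ℂ} {a c₂ c₁ d₂ d₁ : ℂ}

lemma of_analyticAt (hf : AnalyticAt ℂ f a) : HasPrincipalPart f a 0 0 :=
  ⟨f, hf, Eventually.of_forall fun s => by simp⟩

lemma congr (hf : HasPrincipalPart f a c₂ c₁) (h : f =ᶠ[𝓝[≠] a] g) :
    HasPrincipalPart g a c₂ c₁ := by
  obtain ⟨p, hp, he⟩ := hf
  refine ⟨p, hp, ?_⟩
  filter_upwards [he, h] with s h1 h2
  rw [← h2, h1]

lemma add (hf : HasPrincipalPart f a c₂ c₁) (hg : HasPrincipalPart g a d₂ d₁) :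
    HasPrincipalPart (fun s => f s + g s) a (c₂ + d₂) (c₁ + d₁) := by
  obtain ⟨p, hp, hpe⟩ := hf
  obtain ⟨q, hq, hqe⟩ := hg
  refine ⟨fun s => p s + q s, hp.add hq, ?_⟩
  filter_upwards [hpe, hqe] with s h1 h2
  rw [h1, h2]
  ring

/-- Expand `g` to second order at `a`, by splitting off a factor `s - a` twice; the linear term of
`g` carries `c₂` into the residue. -/
lemma mul_analyticAt (hf : HasPrincipalPart f a c₂ c₁) (hg : AnalyticAt ℂ g a) :
    HasPrincipalPart (fun s => f s * g s) a (c₂ * g a) (c₁ * g a + c₂ * deriv g a) := by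
  obtain ⟨r, hr, hre⟩ := hf
  obtain ⟨p, hp, hpa, hpe⟩ := exists_analyticAt_eq_add_mul hg
  obtain ⟨q, hq, -, hqe⟩ := exists_analyticAt_eq_add_mul hp
  refine ⟨fun s => c₂ * q s + c₁ * p s + r s * g s,
    ((analyticAt_const.mul hq).add (analyticAt_const.mul hp)).add (hr.mul hg), ?_⟩
  filter_upwards [hre, self_mem_nhdsWithin] with s h1 hs
  have hs : s - a ≠ 0 := sub_ne_zero.mpr hs
  rw [h1, hpe s, hqe s, hpa]
  field_simp
  ring

lemma neg (hf : HasPrincipalPart f a c₂ c₁) :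
    HasPrincipalPart (fun s => -f s) a (-c₂) (-c₁) := by
  obtain ⟨p, hp, hpe⟩ := hf
  refine ⟨fun s => -p s, hp.neg, ?_⟩
  filter_upwards [hpe] with s h1
  rw [h1]
  ring

lemma sub (hf : HasPrincipalPart f a c₂ c₁) (hg : HasPrincipalPart g a d₂ d₁) :
    HasPrincipalPart (fun s => f s - g s) a (c₂ - d₂) (c₁ - d₁) := by
  simpa only [sub_eq_add_neg] using hf.add hg.neg

/-- The pole must be simple: differentiating a double pole would give a triple one, outside the
scope of `HasPrincipalPart`. -/
lemma deriv_of_simple (hf : HasPrincipalPart f a 0 c₁) :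
    HasPrincipalPart (deriv f) a (-c₁) 0 := by
  obtain ⟨p, hp, hpe⟩ := hf
  refine ⟨deriv p, hp.deriv, ?_⟩
  have h2 := (eventually_eventually_nhdsWithin.mpr hpe)
  filter_upwards [h2, self_mem_nhdsWithin,
    nhdsWithin_le_nhds hp.eventually_analyticAt] with s h1 hs hps
  have hs' : s - a ≠ 0 := sub_ne_zero.mpr hs
  have hs : s ≠ a := hs
  -- Away from `a` the expansion holds on a full neighbourhood of `s`, so it can be differentiated
  -- at `s`.
  rw [hs.nhdsWithin_compl_singleton] at h1
  have h3 : f =ᶠ[𝓝 s] fun z => c₁ / (z - a) + p z := by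
    filter_upwards [h1] with z hz
    rw [hz]
    ring
  have h4 : HasDerivAt (fun z => c₁ / (z - a) + p z)
      ((0 * (s - a) - c₁ * 1) / (s - a) ^ 2 + deriv p s) s :=
    ((hasDerivAt_const s c₁).div ((hasDerivAt_id s).sub_const a) hs').add
      hps.differentiableAt.hasDerivAt
  rw [h3.deriv_eq, h4.deriv]
  ring

lemma comp_add_const {b : ℂ} (hf : HasPrincipalPart f (a + b) c₂ c₁) :
    HasPrincipalPart (fun s => f (s + b)) a c₂ c₁ := by
  obtain ⟨p, hp, hpe⟩ := hf
  have hadd : AnalyticAt ℂ (fun s : ℂ => s + b) a := analyticAt_id.add analyticAt_const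
  refine ⟨fun s => p (s + b), AnalyticAt.fun_comp (f := fun s => s + b) hp hadd, ?_⟩
  rw [eventually_nhdsWithin_iff] at hpe ⊢
  have := hadd.continuousAt.tendsto.eventually hpe
  filter_upwards [this] with s hs hsa
  rw [hs (fun h => hsa (add_right_cancel h)), add_sub_add_right_eq_sub]

lemma meromorphicAt (hf : HasPrincipalPart f a c₂ c₁) : MeromorphicAt f a := by
  obtain ⟨p, hp, hpe⟩ := hf
  have h1 : MeromorphicAt (fun s => s - a) a := (analyticAt_id.sub analyticAt_const).meromorphicAt
  have h2 : MeromorphicAt (fun s => c₂ / (s - a) ^ 2 + c₁ / (s - a) + p s) a :=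
    (((MeromorphicAt.const c₂ a).div (h1.pow 2)).add
      ((MeromorphicAt.const c₁ a).div h1)).add hp.meromorphicAt
  exact h2.congr (hpe.mono fun s hs => hs.symm)

lemma order_eq_neg_two (hf : HasPrincipalPart f a c₂ c₁) (hc : c₂ ≠ 0) :
    meromorphicOrderAt f a = -2 := by
  have hm := hf.meromorphicAt
  obtain ⟨p, hp, hpe⟩ := hf
  refine (meromorphicOrderAt_eq_int_iff (n := -2) hm).mpr
    ⟨fun s => c₂ + c₁ * (s - a) + (s - a) ^ 2 * p s, by fun_prop, by simpa using hc, ?_⟩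
  filter_upwards [hpe, self_mem_nhdsWithin] with s h1 hs
  have hs : s - a ≠ 0 := sub_ne_zero.mpr hs
  rw [h1, zpow_neg, smul_eq_mul]
  norm_cast
  field_simp

lemma order_eq_neg_one (hf : HasPrincipalPart f a 0 c₁) (hc : c₁ ≠ 0) :
    meromorphicOrderAt f a = -1 := by
  have hm := hf.meromorphicAt
  obtain ⟨p, hp, hpe⟩ := hf
  refine (meromorphicOrderAt_eq_int_iff (n := -1) hm).mpr
    ⟨fun s => c₁ + (s - a) * p s, by fun_prop, by simpa using hc, ?_⟩
  filter_upwards [hpe, self_mem_nhdsWithin] with s h1 hs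
  have hs : s - a ≠ 0 := sub_ne_zero.mpr hs
  rw [h1, zpow_neg_one, smul_eq_mul, zero_div, zero_add]
  field_simp

end HasPrincipalPart

/-! ### Filling in removable singularities -/

/-- The function obtained from `f` by filling in its removable singularities. -/
noncomputable def fillIn (f : ℂ → ℂ) (s : ℂ) : ℂ := limUnder (𝓝[≠] s) f

lemma fillIn_eq {f : ℂ → ℂ} {s c : ℂ} (h : Tendsto f (𝓝[≠] s) (𝓝 c)) : fillIn f s = c :=
  h.limUnder_eq

/-- Near `a` but off it, `f` equals its Laurent expansion and is continuous, so the limit is its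
value. Principal parts thus pass from `f` to `fillIn f`. -/
lemma fillIn_eventuallyEq {f : ℂ → ℂ} {a c₂ c₁ : ℂ} (hf : HasPrincipalPart f a c₂ c₁) :
    fillIn f =ᶠ[𝓝[≠] a] f := by
  obtain ⟨p, hp, hpe⟩ := hf
  filter_upwards [eventually_eventually_nhdsWithin.mpr hpe, hpe, self_mem_nhdsWithin,
    nhdsWithin_le_nhds hp.eventually_analyticAt] with s h1 h2 hs hps
  have hs' : s - a ≠ 0 := sub_ne_zero.mpr hs
  have hs : s ≠ a := hs
  rw [hs.nhdsWithin_compl_singleton] at h1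
  have hc : ContinuousAt (fun s => c₂ / (s - a) ^ 2 + c₁ / (s - a) + p s) s := by
    have := hps.continuousAt
    refine ContinuousAt.add (ContinuousAt.add (ContinuousAt.div₀ (by fun_prop) (by fun_prop) ?_)
      (ContinuousAt.div₀ (by fun_prop) (by fun_prop) hs')) this
    exact pow_ne_zero 2 hs'
  rw [h2]
  exact fillIn_eq ((hc.tendsto.congr' (h1.mono fun _ h => h.symm)).mono_left nhdsWithin_le_nhds)

lemma fillIn_of_removable {f : ℂ → ℂ} {a : ℂ} (hf : HasPrincipalPart f a 0 0) :
    AnalyticAt ℂ (fillIn f) a ∧ Tendsto f (𝓝[≠] a) (𝓝 (fillIn f a)) := by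
  have h := fillIn_eventuallyEq hf
  obtain ⟨p, hp, hpe⟩ := hf
  have hpe' : p =ᶠ[𝓝[≠] a] f := hpe.mono fun s hs => by rw [hs]; simp
  have ht : Tendsto f (𝓝[≠] a) (𝓝 (p a)) :=
    (hp.continuousAt.tendsto.mono_left nhdsWithin_le_nhds).congr' hpe'
  have ha : fillIn f a = p a := fillIn_eq ht
  refine ⟨hp.congr ?_, by rwa [ha]⟩
  have h3 : p =ᶠ[𝓝[≠] a] fillIn f := hpe'.trans h.symm
  rw [EventuallyEq, eventually_nhdsWithin_iff] at h3
  filter_upwards [h3] with s hs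
  by_cases hsa : s = a
  · rw [hsa, ha]
  · exact hs hsa

/-! ### Singularities of the individual terms -/

lemma eventually_ne_intCast (a : ℂ) : ∀ᶠ s : ℂ in 𝓝[≠] a, ∀ m : ℤ, s ≠ m := by
  have hcl : IsClosed ((fun m : ℤ => (m : ℂ)) '' {m : ℤ | (m : ℂ) ≠ a}) :=
    Complex.isClosedEmbedding_intCast.isClosedMap _ (isClosed_discrete _)
  have hmem : a ∈ ((fun m : ℤ => (m : ℂ)) '' {m : ℤ | (m : ℂ) ≠ a})ᶜ := by
    rintro ⟨m, hm, rfl⟩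
    exact hm rfl
  filter_upwards [nhdsWithin_le_nhds (hcl.isOpen_compl.mem_nhds hmem), self_mem_nhdsWithin]
    with s hs hsa m hm
  exact hs ⟨m, fun h => hsa (hm.trans h), hm.symm⟩

lemma analyticAt_Gamma {s : ℂ} (hs : ∀ m : ℕ, s ≠ -m) : AnalyticAt ℂ Complex.Gamma s := by
  have h : AnalyticAt ℂ (fun s : ℂ => ((Complex.Gamma s)⁻¹)⁻¹) s :=
    (Complex.differentiable_one_div_Gamma.analyticAt s).inv
      (inv_ne_zero (Complex.Gamma_ne_zero hs))
  simpa only [inv_inv] using h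

lemma analyticAt_digamma {s : ℂ} (hs : ∀ m : ℕ, s ≠ -m) : AnalyticAt ℂ Complex.digamma s := by
  have h := analyticAt_Gamma hs
  exact h.deriv.div h (Complex.Gamma_ne_zero hs)

lemma analyticAt_riemannZeta {s : ℂ} (hs : s ≠ 1) : AnalyticAt ℂ riemannZeta s := by
  have h : DifferentiableOn ℂ riemannZeta {1}ᶜ := fun z hz =>
    (differentiableAt_riemannZeta hz).differentiableWithinAt
  exact h.analyticAt (isOpen_compl_singleton.mem_nhds hs)

lemma hasPrincipalPart_riemannZeta : HasPrincipalPart riemannZeta 1 0 1 := by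
  -- Euler's constant is the limit of `ζ(s) - 1/(s-1)` at `1`, so this value makes the singularity
  -- removable.
  set G : ℂ → ℂ := Function.update (fun s => riemannZeta s - 1 / (s - 1)) 1
    Real.eulerMascheroniConstant with hG
  have hGe : ∀ s ≠ 1, G s = riemannZeta s - 1 / (s - 1) := fun s hs => by
    rw [hG, Function.update_of_ne hs]
  refine ⟨G, ?_, ?_⟩
  · refine Complex.analyticAt_of_differentiable_on_punctured_nhds_of_continuousAt ?_ ?_
    · filter_upwards [self_mem_nhdsWithin] with s hs
      have hs : s ≠ 1 := hs
      have hd : DifferentiableAt ℂ (fun s => riemannZeta s - 1 / (s - 1)) s :=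
        (differentiableAt_riemannZeta hs).sub
          (DifferentiableAt.div (by fun_prop) (by fun_prop) (sub_ne_zero.mpr hs))
      refine hd.congr_of_eventuallyEq ?_
      filter_upwards [isOpen_compl_singleton.mem_nhds hs] with z hz
      exact hGe z hz
    · rw [hG, continuousAt_update_same]
      exact tendsto_riemannZeta_sub_one_div
  · filter_upwards [self_mem_nhdsWithin] with s hs
    rw [hGe s hs]
    ring

/-- Induct leftwards with `ψ(s) = ψ(s+1) - 1/s`. The pole at `0` comes from `1/s`; at later steps
`1/s` is regular and the pole is inherited from `ψ(s+1)`. -/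
lemma hasPrincipalPart_digamma (m : ℕ) : HasPrincipalPart Complex.digamma (-m) 0 (-1) := by
  induction m with
  | zero =>
    have h1 : HasPrincipalPart (fun s => Complex.digamma (s + 1)) 0 0 0 :=
      HasPrincipalPart.comp_add_const (HasPrincipalPart.of_analyticAt
        (analyticAt_digamma fun m h => by
          have := congrArg Complex.re h
          simp at this
          linarith [(Nat.cast_nonneg m : (0 : ℝ) ≤ m)]))
    have h2 : HasPrincipalPart (fun s : ℂ => s⁻¹) 0 0 1 :=
      ⟨0, analyticAt_const, Eventually.of_forall fun s => by simp⟩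
    have h3 := h1.sub h2
    rw [Nat.cast_zero, neg_zero]
    rw [sub_zero, zero_sub] at h3
    refine h3.congr ?_
    filter_upwards [eventually_ne_intCast 0] with s hs
    rw [Complex.digamma_apply_add_one s fun m h => hs (-m) (by rw [h]; push_cast; ring)]
    ring
  | succ m ih =>
    have h1 : HasPrincipalPart (fun s => Complex.digamma (s + 1)) (-((m + 1 : ℕ) : ℂ)) 0 (-1) := by
      refine HasPrincipalPart.comp_add_const ?_
      convert ih using 1
      push_cast
      ring
    have h2 : HasPrincipalPart (fun s : ℂ => s⁻¹) (-((m + 1 : ℕ) : ℂ)) 0 0 :=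
      HasPrincipalPart.of_analyticAt (analyticAt_id.inv (neg_ne_zero.mpr
        (Nat.cast_ne_zero.mpr m.succ_ne_zero)))
    have h3 := h1.sub h2
    rw [sub_zero, sub_zero] at h3
    refine h3.congr ?_
    filter_upwards [eventually_ne_intCast (-((m + 1 : ℕ) : ℂ))] with s hs
    rw [Complex.digamma_apply_add_one s fun m h => hs (-m) (by rw [h]; push_cast; ring)]
    ring

lemma ne_neg_natCast_of_re_pos {s : ℂ} (hs : 0 < s.re) (m : ℕ) : s ≠ -m := by
  rintro rfl
  simp at hs
  linarith [(Nat.cast_nonneg m : (0 : ℝ) ≤ m)]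

lemma Gamma_one_sub_mul_hankelI {k : ℕ} (hk : 1 ≤ k) {ε : ℝ} (hε : 0 < ε) (h1 : ε < Real.pi)
    (h2 : k * ε < 2 * Real.pi) {s : ℂ} (hs : 0 < s.re) (hsm : ∀ m : ℤ, s ≠ m) :
    Complex.Gamma (1 - s) * hankelI k ε s
      = -((Complex.Gamma s)⁻¹ * mellin (fun t => (edgeKernel k t : ℂ)) s) := by
  have hpi : (Real.pi : ℂ) ≠ 0 := by exact_mod_cast Real.pi_ne_zero
  have hG := Complex.Gamma_ne_zero (ne_neg_natCast_of_re_pos hs)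
  have hsin : Complex.sin (Real.pi * s) ≠ 0 := by
    rw [Complex.sin_ne_zero_iff]
    intro m hm
    rw [mul_comm] at hm
    exact hsm m (mul_right_cancel₀ hpi hm)
  have hrefl := Complex.Gamma_mul_Gamma_one_sub s
  rw [hankelI_eq_mellin hk hε h1 h2 hs]
  have : Complex.Gamma (1 - s) = Real.pi / Complex.sin (Real.pi * s) / Complex.Gamma s := by
    rw [← hrefl]
    field_simp
  rw [this]
  field_simp

/-- For `re a ≤ 0` the factor `Γ(1-s)` is analytic. For `re a > 0` the product agrees off the
integers with `-M/Γ`, which is analytic because `1/Γ` is entire. -/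
lemma hasPrincipalPart_Gamma_one_sub_mul_hankelI {k : ℕ} (hk : 1 ≤ k) {ε : ℝ} (hε : 0 < ε)
    (h1 : ε < Real.pi) (h2 : k * ε < 2 * Real.pi) (a : ℂ) :
    HasPrincipalPart (fun s => Complex.Gamma (1 - s) * hankelI k ε s) a 0 0 := by
  rcases le_or_gt a.re 0 with ha | ha
  · have hG : AnalyticAt ℂ Complex.Gamma (1 - a) :=
      analyticAt_Gamma (ne_neg_natCast_of_re_pos (by simp; linarith))
    exact HasPrincipalPart.of_analyticAt ((hG.fun_comp (f := fun s => 1 - s)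
      (analyticAt_const.sub analyticAt_id)).mul
        ((differentiable_hankelI hk hε h1 h2).analyticAt a))
  · have hopen : IsOpen {s : ℂ | 0 < s.re} := isOpen_lt continuous_const Complex.continuous_re
    have hM : AnalyticAt ℂ (mellin (fun t => (edgeKernel k t : ℂ))) a :=
      DifferentiableOn.analyticAt (s := {s : ℂ | 0 < s.re})
        (fun s hs => (differentiableAt_mellin_edgeKernel hk hs).differentiableWithinAt)
        (hopen.mem_nhds ha)
    refine (HasPrincipalPart.of_analyticAt
      ((Complex.differentiable_one_div_Gamma.analyticAt a).mul hM).neg).congr ?_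
    filter_upwards [eventually_ne_intCast a, nhdsWithin_le_nhds (hopen.mem_nhds ha)] with s hs hs0
    exact (Gamma_one_sub_mul_hankelI hk hε h1 h2 hs0 hs).symm

/-- The part of `contourFormula` that involves the digamma function. -/
noncomputable def digammaPart (k : ℕ) (s : ℂ) : ℂ :=
  (Complex.digamma s * riemannZeta s + deriv riemannZeta s - riemannZeta s * Complex.log k)
    * (k : ℂ) ^ (-s)

lemma contourFormula_eq (k : ℕ) (ε : ℝ) : contourFormula k ε = fun s =>
    Complex.Gamma (1 - s) * hankelI k ε s + riemannZeta (s + 1) - digammaPart k s := by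
  ext s
  rw [contourFormula, digammaPart]
  ring

lemma hasDerivAt_cpow_neg {k : ℕ} (hk : 1 ≤ k) (s : ℂ) :
    HasDerivAt (fun w : ℂ => (k : ℂ) ^ (-w)) (-((k : ℂ) ^ (-s) * Complex.log k)) s := by
  have hk0 : (k : ℂ) ≠ 0 := Nat.cast_ne_zero.mpr (by omega)
  have := (hasDerivAt_neg s).const_cpow (c := (k : ℂ)) (Or.inl hk0)
  simpa using this

lemma analyticAt_cpow_neg {k : ℕ} (hk : 1 ≤ k) (s : ℂ) :
    AnalyticAt ℂ (fun w : ℂ => (k : ℂ) ^ (-w)) s :=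
  Differentiable.analyticAt (fun w => (hasDerivAt_cpow_neg hk w).differentiableAt) s

lemma hasPrincipalPart_digammaPart {k : ℕ} (hk : 1 ≤ k) {a c : ℂ} (ha : a ≠ 1)
    (h : HasPrincipalPart Complex.digamma a 0 c) :
    HasPrincipalPart (digammaPart k) a 0 (c * riemannZeta a * (k : ℂ) ^ (-a)) := by
  have hz := analyticAt_riemannZeta ha
  have h1 := ((h.mul_analyticAt hz).add (HasPrincipalPart.of_analyticAt hz.deriv)).sub
    (HasPrincipalPart.of_analyticAt (hz.mul (analyticAt_const (v := Complex.log k))))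
  have h2 : HasPrincipalPart (digammaPart k) a _ _ :=
    h1.mul_analyticAt (analyticAt_cpow_neg hk a)
  simpa using h2

/-- The residue uses `ψ(1) = -γ`. The `log k` from `-ζ(s) log k` cancels against the one from the
double pole of `ζ'` times the derivative of `k^{-s}`. -/
lemma hasPrincipalPart_digammaPart_one {k : ℕ} (hk : 1 ≤ k) :
    HasPrincipalPart (digammaPart k) 1 (-(1 / k)) (-(Real.eulerMascheroniConstant / k)) := by
  have hz := hasPrincipalPart_riemannZeta
  have hψ : AnalyticAt ℂ Complex.digamma 1 :=
    analyticAt_digamma (ne_neg_natCast_of_re_pos (by simp))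
  have h1 := ((hz.mul_analyticAt hψ).add hz.deriv_of_simple).sub
    (hz.mul_analyticAt (analyticAt_const (v := Complex.log k)))
  have h2 := h1.mul_analyticAt (analyticAt_cpow_neg hk 1)
  rw [(hasDerivAt_cpow_neg hk 1).deriv, Complex.digamma_one, Complex.cpow_neg_one] at h2
  have h3 : HasPrincipalPart (digammaPart k) 1 _ _ := h2.congr (Eventually.of_forall fun s => by
    simp only [digammaPart]
    ring)
  convert h3 using 1
  · ring
  · ring

lemma digamma_removable {a : ℂ} (ha : ∀ m : ℕ, a ≠ -m) :
    HasPrincipalPart Complex.digamma a 0 0 :=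
  HasPrincipalPart.of_analyticAt (analyticAt_digamma ha)

lemma hasPrincipalPart_riemannZeta_add_one {a : ℂ} (ha : a ≠ 0) :
    HasPrincipalPart (fun s => riemannZeta (s + 1)) a 0 0 :=
  HasPrincipalPart.comp_add_const (HasPrincipalPart.of_analyticAt
    (analyticAt_riemannZeta (by simpa using ha)))

/-! ### The contour formula: principal parts and agreement with the series -/

section contour

variable {k : ℕ} {ε : ℝ}

lemma hasPrincipalPart_contourFormula_one (hk : 1 ≤ k) (hε : 0 < ε) (h1 : ε < Real.pi) (h2 : k * ε < 2 * Real.pi) :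
    HasPrincipalPart (contourFormula k ε) 1 (1 / k) (Real.eulerMascheroniConstant / k) := by
  have h := ((hasPrincipalPart_Gamma_one_sub_mul_hankelI hk hε h1 h2 1).add
    (hasPrincipalPart_riemannZeta_add_one one_ne_zero)).sub (hasPrincipalPart_digammaPart_one hk)
  rw [contourFormula_eq]
  simpa using h

lemma hasPrincipalPart_contourFormula_zero (hk : 1 ≤ k) (hε : 0 < ε) (h1 : ε < Real.pi) (h2 : k * ε < 2 * Real.pi) :
    HasPrincipalPart (contourFormula k ε) 0 0 (1 + riemannZeta 0) := by
  have hz : HasPrincipalPart (fun s => riemannZeta (s + 1)) 0 0 1 :=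
    HasPrincipalPart.comp_add_const (by simpa using hasPrincipalPart_riemannZeta)
  have hψ : HasPrincipalPart Complex.digamma 0 0 (-1) := by
    simpa using hasPrincipalPart_digamma 0
  have h := ((hasPrincipalPart_Gamma_one_sub_mul_hankelI hk hε h1 h2 0).add hz).sub
    (hasPrincipalPart_digammaPart hk zero_ne_one hψ)
  rw [contourFormula_eq]
  simpa using h

lemma hasPrincipalPart_contourFormula_neg_nat (hk : 1 ≤ k) (hε : 0 < ε) (h1 : ε < Real.pi)
    (h2 : k * ε < 2 * Real.pi) {m : ℕ} (hm : m ≠ 0) :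
    HasPrincipalPart (contourFormula k ε) (-m) 0 ((k : ℂ) ^ m * riemannZeta (-m)) := by
  have hm1 : (-m : ℂ) ≠ 1 := (ne_neg_natCast_of_re_pos (by simp) m).symm
  have h := ((hasPrincipalPart_Gamma_one_sub_mul_hankelI hk hε h1 h2 (-m)).add
    (hasPrincipalPart_riemannZeta_add_one (neg_ne_zero.mpr (Nat.cast_ne_zero.mpr hm)))).sub
      (hasPrincipalPart_digammaPart hk hm1 (hasPrincipalPart_digamma m))
  rw [contourFormula_eq]
  simpa [mul_comm] using h

lemma hasPrincipalPart_contourFormula_of_ne (hk : 1 ≤ k) (hε : 0 < ε) (h1 : ε < Real.pi)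
    (h2 : k * ε < 2 * Real.pi) {a : ℂ} (ha1 : a ≠ 1) (ha : ∀ m : ℕ, a ≠ -m) :
    HasPrincipalPart (contourFormula k ε) a 0 0 := by
  have ha0 : a ≠ 0 := by simpa using ha 0
  have h := ((hasPrincipalPart_Gamma_one_sub_mul_hankelI hk hε h1 h2 a).add
    (hasPrincipalPart_riemannZeta_add_one ha0)).sub
      (hasPrincipalPart_digammaPart hk ha1 (digamma_removable ha))
  rw [contourFormula_eq]
  simpa using h

lemma hasPrincipalPart_contourFormula_of_notMem_poles (hk : 1 ≤ k) (hε : 0 < ε) (h1 : ε < Real.pi)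
    (h2 : k * ε < 2 * Real.pi) {a : ℂ} (ha : a ∉ poles) :
    HasPrincipalPart (contourFormula k ε) a 0 0 := by
  have ha1 : a ≠ 1 := fun h => ha (Or.inl h)
  have ha0 : a ≠ 0 := fun h => ha (Or.inr (Or.inl h))
  by_cases h : ∀ m : ℕ, a ≠ -m
  · exact hasPrincipalPart_contourFormula_of_ne hk hε h1 h2 ha1 h
  push Not at h
  obtain ⟨m, rfl⟩ := h
  have hm : m ≠ 0 := by
    rintro rfl
    simp at ha0
  have hpp := hasPrincipalPart_contourFormula_neg_nat hk hε h1 h2 hm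
  -- At even `m` the residue is killed by a trivial zero of `ζ`; odd `m` would make `-m` one of the
  -- poles.
  rcases Nat.even_or_odd' m with ⟨j, rfl | rfl⟩
  · obtain ⟨i, rfl⟩ := Nat.exists_eq_succ_of_ne_zero (show j ≠ 0 by omega)
    have hz : riemannZeta (-((2 * (i + 1) : ℕ) : ℂ)) = 0 := by
      rw [← riemannZeta_neg_two_mul_nat_add_one i]
      push_cast
      ring_nf
    rwa [Nat.succ_eq_add_one, hz, mul_zero] at hpp
  · refine absurd (Or.inr (Or.inr ⟨j + 1, by omega, ?_⟩)) ha
    push_cast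
    ring

lemma exists_hasPrincipalPart_contourFormula (hk : 1 ≤ k) (hε : 0 < ε) (h1 : ε < Real.pi)
    (h2 : k * ε < 2 * Real.pi) (a : ℂ) :
    ∃ c₂ c₁, HasPrincipalPart (contourFormula k ε) a c₂ c₁ := by
  by_cases ha1 : a = 1
  · exact ha1 ▸ ⟨_, _, hasPrincipalPart_contourFormula_one hk hε h1 h2⟩
  by_cases h : ∀ m : ℕ, a ≠ -m
  · exact ⟨_, _, hasPrincipalPart_contourFormula_of_ne hk hε h1 h2 ha1 h⟩
  push Not at h
  obtain ⟨m, rfl⟩ := h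
  rcases eq_or_ne m 0 with rfl | hm
  · exact ⟨0, 1 + riemannZeta 0, by simpa using hasPrincipalPart_contourFormula_zero hk hε h1 h2⟩
  · exact ⟨_, _, hasPrincipalPart_contourFormula_neg_nat hk hε h1 h2 hm⟩

lemma continuousAt_contourFormula (hk : 1 ≤ k) (hε : 0 < ε) (h1 : ε < Real.pi)
    (h2 : k * ε < 2 * Real.pi) {s : ℂ} (hs : ∀ m : ℤ, s ≠ m) :
    ContinuousAt (contourFormula k ε) s := by
  have hs1 : s ≠ 1 := by simpa using hs 1
  have hs0 : s + 1 ≠ 1 := by simpa using hs 0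
  have hψ := (analyticAt_digamma (s := s) fun m h => hs (-m) (by rw [h]; push_cast; ring)).continuousAt
  have hζ := (analyticAt_riemannZeta hs1).continuousAt
  have hζ' := (analyticAt_riemannZeta hs1).deriv.continuousAt
  have hpow := (analyticAt_cpow_neg hk s).continuousAt
  have hI := (differentiable_hankelI hk hε h1 h2).continuous.continuousAt (x := s)
  have hΓ : ContinuousAt (fun s => Complex.Gamma (1 - s)) s :=
    ContinuousAt.comp (g := Complex.Gamma) (analyticAt_Gamma fun m h => hs (m + 1) (by
      push_cast
      linear_combination -h)).continuousAt (by fun_prop)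
  have hζ1 : ContinuousAt (fun s => riemannZeta (s + 1)) s :=
    ContinuousAt.comp (g := riemannZeta) (analyticAt_riemannZeta hs0).continuousAt (by fun_prop)
  exact ((hΓ.mul hI).add hζ1).sub (hpow.mul (((hψ.mul hζ).add hζ').sub (hζ.mul_const _)))

/-- The product rule for `Γ(s) k^{-s} ζ(s)`, divided by `Γ(s)`, turns `Γ'/Γ` into `ψ` and yields the
bracket of the formula. -/
lemma contourFormula_eq_zetaA (hk : 1 ≤ k) (hε : 0 < ε) (h1 : ε < Real.pi)
    (h2 : k * ε < 2 * Real.pi) {s : ℂ} (hs : 1 < s.re) (hsm : ∀ m : ℤ, s ≠ m) :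
    contourFormula k ε s = zetaA k s := by
  have hs0 : 0 < s.re := by linarith
  have hs1 : s ≠ 1 := by simpa using hsm 1
  have hne := ne_neg_natCast_of_re_pos hs0
  have hG := Complex.Gamma_ne_zero hne
  have hd := (Complex.differentiableAt_Gamma s hne).hasDerivAt.mul
    ((hasDerivAt_cpow_neg hk s).mul (differentiableAt_riemannZeta hs1).hasDerivAt)
  have hd' : deriv (fun w => Complex.Gamma w * ((k : ℂ) ^ (-w) * riemannZeta w)) s = _ := hd.deriv
  have hmain := Gamma_mul_zetaA_sub hk hs
  rw [hd', Pi.mul_apply] at hmain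
  have hz : zetaA k s = riemannZeta (s + 1)
      + (Complex.Gamma s)⁻¹ * (Complex.Gamma s * (zetaA k s - riemannZeta (s + 1))) := by
    rw [inv_mul_cancel_left₀ hG]
    ring
  rw [hz, hmain, contourFormula, Gamma_one_sub_mul_hankelI hk hε h1 h2 hs0 hsm,
    Complex.digamma_def, logDeriv_apply]
  field_simp
  ring

lemma contourFormula_eq_contourFormula (hk : 1 ≤ k) {δ : ℝ} (hδ : 0 < δ) (hδ1 : δ < Real.pi)
    (hδ2 : k * δ < 2 * Real.pi) (hε : 0 < ε) (h1 : ε < Real.pi) (h2 : k * ε < 2 * Real.pi) :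
    contourFormula k δ = contourFormula k ε := by
  ext s
  rw [contourFormula, contourFormula, hankelI_eq hk hδ hδ1 hδ2 hε h1 h2]

end contour

lemma riemannZeta_one_sub_two_mul {j : ℕ} (hj : 1 ≤ j) :
    riemannZeta (1 - 2 * (j : ℂ)) = -(bernoulli (2 * j) : ℂ) / (2 * j) := by
  have h := riemannZeta_neg_nat_eq_bernoulli (2 * j - 1)
  rw [Nat.sub_add_cancel (by omega), Nat.cast_sub (by omega), Odd.neg_one_pow ⟨j - 1, by omega⟩] at h
  push_cast at h
  rw [neg_sub] at h
  rw [h]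
  ring

/-- If `B_{2j}` vanished, Euler's formula would give `ζ(2j) = 0`, impossible in the half-plane `re s
> 1`. -/
lemma riemannZeta_one_sub_two_mul_ne_zero {j : ℕ} (hj : 1 ≤ j) :
    riemannZeta (1 - 2 * (j : ℂ)) ≠ 0 := by
  rw [riemannZeta_one_sub_two_mul hj]
  have hj0 : (j : ℂ) ≠ 0 := Nat.cast_ne_zero.mpr (by omega)
  refine div_ne_zero (neg_ne_zero.mpr fun hB => ?_) (mul_ne_zero two_ne_zero hj0)
  have h : riemannZeta (2 * j) ≠ 0 := by
    refine riemannZeta_ne_zero_of_one_lt_re ?_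
    have : (1 : ℝ) ≤ j := by exact_mod_cast hj
    simp
    linarith
  rw [riemannZeta_two_mul_nat (by omega), hB] at h
  simp at h

end HarmonicZeta

theorem theorem1p2 (k : ℕ) (hk : 1 ≤ k) :
    -- the `A k n` are the coefficients of their generating function
    (∀ x : ℂ, ‖x‖ < 1 →
      HasSum (fun n : ℕ => (HarmonicZeta.A k n : ℂ) * x ^ n)
        (-Complex.log (1 - x) / (1 - x ^ k))) ∧
    -- the Dirichlet series converges absolutely for `re s > 1`
    (∀ s : ℂ, 1 < s.re → LSeriesSummable (fun n => (HarmonicZeta.A k n : ℂ)) s) ∧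
    -- the contour integral converges for all `s` and is an entire function of `s`
    (∀ ε : ℝ, 0 < ε → ε < Real.pi → k * ε < 2 * Real.pi →
      (∀ s : ℂ, HarmonicZeta.HankelConverges k ε s) ∧
      Differentiable ℂ (HarmonicZeta.hankelI k ε)) ∧
    -- meromorphic continuation, given by the contour formula
    ∃ Z : ℂ → ℂ,
      (∀ s : ℂ, 1 < s.re → Z s = HarmonicZeta.zetaA k s) ∧
      Meromorphic Z ∧
      DifferentiableOn ℂ Z HarmonicZeta.polesᶜ ∧
      (∀ ε : ℝ, 0 < ε → ε < Real.pi → k * ε < 2 * Real.pi →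
        -- away from the integers every term of the formula is regular
        (∀ s : ℂ, (∀ m : ℤ, s ≠ m) → Z s = HarmonicZeta.contourFormula k ε s) ∧
        -- at the integers that are not poles the formula holds as a limit
        (∀ s : ℂ, s ∉ HarmonicZeta.poles →
          Tendsto (HarmonicZeta.contourFormula k ε) (𝓝[≠] s) (𝓝 (Z s)))) ∧
      -- double pole at `1`
      meromorphicOrderAt Z 1 = -2 ∧
      HarmonicZeta.HasPrincipalPart Z 1 (1 / k) (Real.eulerMascheroniConstant / k) ∧
      -- simple pole at `0`
      meromorphicOrderAt Z 0 = -1 ∧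
      HarmonicZeta.HasPrincipalPart Z 0 0 (1 + riemannZeta 0) ∧
      -- simple poles at `1 - 2 j`
      (∀ j : ℕ, 1 ≤ j →
        meromorphicOrderAt Z (1 - 2 * (j : ℂ)) = -1 ∧
        HarmonicZeta.HasPrincipalPart Z (1 - 2 * (j : ℂ)) 0
          ((k : ℂ) ^ (2 * j - 1) * riemannZeta (1 - 2 * (j : ℂ))) ∧
        (k : ℂ) ^ (2 * j - 1) * riemannZeta (1 - 2 * (j : ℂ))
          = -(k : ℂ) ^ (2 * j - 1) * (bernoulli (2 * j) : ℂ) / (2 * j)) := by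
  obtain ⟨ε₀, hε₀, hε₀1, hε₀2⟩ : ∃ ε : ℝ, 0 < ε ∧ ε < Real.pi ∧ k * ε < 2 * Real.pi := by
    have hk0 : (1 : ℝ) ≤ k := by exact_mod_cast hk
    refine ⟨1 / k, by positivity, lt_of_le_of_lt ?_ (by linarith [Real.pi_gt_three] : 1 < Real.pi), ?_⟩
    · rwa [div_le_one (by linarith)]
    · rw [mul_one_div_cancel (by linarith)]
      linarith [Real.pi_gt_three]
  have hk0 : (k : ℂ) ≠ 0 := Nat.cast_ne_zero.mpr (by omega)
  -- One radius is fixed to define the continuation; other radii give the same function.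
  set F := HarmonicZeta.contourFormula k ε₀
  have hnear : ∀ a : ℂ, HarmonicZeta.fillIn F =ᶠ[𝓝[≠] a] F := fun a => by
    obtain ⟨c₂, c₁, h⟩ :=
      HarmonicZeta.exists_hasPrincipalPart_contourFormula hk hε₀ hε₀1 hε₀2 a
    exact HarmonicZeta.fillIn_eventuallyEq h
  have hpp : ∀ {a c₂ c₁ : ℂ}, HarmonicZeta.HasPrincipalPart F a c₂ c₁ →
      HarmonicZeta.HasPrincipalPart (HarmonicZeta.fillIn F) a c₂ c₁ :=
    fun h => h.congr (hnear _).symm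
  have hreg : ∀ {a : ℂ}, a ∉ HarmonicZeta.poles →
      AnalyticAt ℂ (HarmonicZeta.fillIn F) a ∧
        Tendsto F (𝓝[≠] a) (𝓝 (HarmonicZeta.fillIn F a)) := fun ha =>
    HarmonicZeta.fillIn_of_removable
      (HarmonicZeta.hasPrincipalPart_contourFormula_of_notMem_poles hk hε₀ hε₀1 hε₀2 ha)
  refine ⟨fun x hx => HarmonicZeta.hasSum_A hk hx,
    fun s hs => HarmonicZeta.lseriesSummable_A k hs,
    fun ε hε h1 h2 => ⟨HarmonicZeta.hankelConverges hk hε h1 h2,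
      HarmonicZeta.differentiable_hankelI hk hε h1 h2⟩,
    HarmonicZeta.fillIn F, fun s hs => ?_, fun a => ?_,
    fun s hs => (hreg hs).1.differentiableAt.differentiableWithinAt,
    fun ε hε h1 h2 => ?_, ?_, ?_, ?_, ?_, fun j hj => ?_⟩
  -- The formula is known to equal the series only off the integers. Continuity of the series covers
  -- the integers `s ≥ 2` as well.
  · refine HarmonicZeta.fillIn_eq (((HarmonicZeta.analyticAt_zetaA k hs).continuousAt.tendsto.mono_left
      nhdsWithin_le_nhds).congr' ?_)
    filter_upwards [HarmonicZeta.eventually_ne_intCast s, nhdsWithin_le_nhds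
      ((isOpen_lt continuous_const Complex.continuous_re).mem_nhds hs)] with z hz hz1
    exact (HarmonicZeta.contourFormula_eq_zetaA hk hε₀ hε₀1 hε₀2 hz1 hz).symm
  · obtain ⟨c₂, c₁, h⟩ :=
      HarmonicZeta.exists_hasPrincipalPart_contourFormula hk hε₀ hε₀1 hε₀2 a
    exact (hpp h).meromorphicAt
  · rw [HarmonicZeta.contourFormula_eq_contourFormula hk hε h1 h2 hε₀ hε₀1 hε₀2]
    refine ⟨fun s hs => HarmonicZeta.fillIn_eq ?_, fun s hs => (hreg hs).2⟩
    exact (HarmonicZeta.continuousAt_contourFormula hk hε₀ hε₀1 hε₀2 hs).tendsto.mono_left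
      nhdsWithin_le_nhds
  · exact (hpp (HarmonicZeta.hasPrincipalPart_contourFormula_one hk hε₀ hε₀1 hε₀2)).order_eq_neg_two
      (one_div_ne_zero hk0)
  · exact hpp (HarmonicZeta.hasPrincipalPart_contourFormula_one hk hε₀ hε₀1 hε₀2)
  · refine (hpp (HarmonicZeta.hasPrincipalPart_contourFormula_zero hk hε₀ hε₀1 hε₀2)).order_eq_neg_one ?_
    -- `ζ(0) = -1/2`, so the residue is `1/2`.
    rw [riemannZeta_zero]
    norm_num
  · exact hpp (HarmonicZeta.hasPrincipalPart_contourFormula_zero hk hε₀ hε₀1 hε₀2)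
  · have h := hpp (HarmonicZeta.hasPrincipalPart_contourFormula_neg_nat hk hε₀ hε₀1 hε₀2
      (show 2 * j - 1 ≠ 0 by omega))
    have hcast : -((2 * j - 1 : ℕ) : ℂ) = 1 - 2 * (j : ℂ) := by
      rw [Nat.cast_sub (by omega)]
      push_cast
      ring
    rw [hcast] at h
    refine ⟨h.order_eq_neg_one (mul_ne_zero (pow_ne_zero _ hk0)
      (HarmonicZeta.riemannZeta_one_sub_two_mul_ne_zero hj)), h, ?_⟩
    rw [HarmonicZeta.riemannZeta_one_sub_two_mul hj]
    ring
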